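/- There is an absolute constant $C_1>0$ such that the following holds for every continuous, strictly positive function $V:[0,1]\to\mathbb{R}$. Write $\|\cdot\|_{L^2}$ for the norm of $L^2([0,1])$, and let $\mathcal{P}_+$ be the set of strictly positive (continuous) functions on $[0,1]$ that are square integrable together with their first weak derivative. The operator $-\partial_{xx}^2+V$ on $[0,1]$ with Neumann boundary conditions has a nondecreasing sequence of eigenvalues $(\mu_n)_{n\ge 0}$ with eigenfunctions $(e_n)_{n\ge 0}$, $$e_n''-Ve_n=-\mu_n e_n,\qquad e_n'(0)=e_n'(1)=0,$$ forming a complete orthonormal system of $L^2([0,1])$; and for every $v_0\in\mathcal{P}_+$ the problem $$\partial_t v=\partial_{xx}^2v-V(x)v,\qquad \partial_xv(t,0)=\partial_xv(t,1)=0,\qquad v(0,x)=v_0(x)$$ has a solution $v$ (classical for $t>0$, i.e. $v,\partial_xv,\partial_{xx}^2v$ are continuous on $]0,\infty[\times[0,1]$ and the equation holds there, with $v(0,\cdot)=v_0$ and $v(t,\cdot)\to v_0$ in $L^2$ as $t\to0^+$). For any such $(\mu_n),(e_n)$, put $c_n(f)=\int_0^1e_n(x)f(x)\,dx$ and $$h_1(t)=C_1\sqrt{\sum_{n=1}^\infty(1+\mu_n)e^{-2(\mu_n-\mu_0)t}}\qquad(t>0).$$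 The series converges for every $t>0$, and $h_1$, which does not depend on $v_0$, is strictly decreasing on $]0,\infty[$ with limit $0$ at infinity. Moreover, for every $v_0\in\mathcal{P}_+$ and every solution $v$ of the above problem, with $g(t)=\int_0^1v(t,\xi)\,d\xi$, $$\Big|e^{\mu_0t}g(t)-c_0(v_0)\int_0^1e_0(\xi)\,d\xi\Big|\le e^{-(\mu_1-\mu_0)t}\,\|v_0-c_0(v_0)e_0\|_{L^2}\,\|1-c_0(1)e_0\|_{L^2}\qquad\text{for all }t\ge0,$$ $$\sup_{x\in[0,1]}\big|e^{\mu_0t}v(t,x)-c_0(v_0)e_0(x)\big|\le\|v_0-c_0(v_0)e_0\|_{L^2}\,h_1(t)\qquad\text{for all }t>0.$$ -/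

import Mathlib

open Set Filter Topology MeasureTheory

namespace NeumannHeat

/-- `w` is a weak derivative of `f` on `(0,1)`, tested against smooth functions compactly
supported in `(0,1)`. -/
def HasWeakDeriv (f w : ℝ → ℝ) : Prop :=
  ∀ φ : ℝ → ℝ, ContDiff ℝ (⊤ : ℕ∞) φ → HasCompactSupport φ → tsupport φ ⊆ Ioo 0 1 →
    ∫ x in (0 : ℝ)..1, f x * deriv φ x = -∫ x in (0 : ℝ)..1, w x * φ x

/-- The set `𝒫₊`: strictly positive functions on `[0,1]` which are square integrable together with
their first weak derivative (the continuous representative is the one that is meant). -/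
structure PPlus (f : ℝ → ℝ) : Prop where
  continuousOn : ContinuousOn f (Icc 0 1)
  pos : ∀ x ∈ Icc (0 : ℝ) 1, 0 < f x
  memLp : MemLp f 2 (volume.restrict (Icc 0 1))
  weakDeriv : ∃ w : ℝ → ℝ, MemLp w 2 (volume.restrict (Icc 0 1)) ∧ HasWeakDeriv f w

/-- `e'' - V e = -μ e` on `[0,1]` and `e'(0) = e'(1) = 0` (one-sided derivatives at the
end points; `d` is `e'`). -/
def IsNeumannEigenpair (V : ℝ → ℝ) (μ : ℝ) (e : ℝ → ℝ) : Prop :=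
  ∃ d : ℝ → ℝ,
    (∀ x ∈ Icc (0 : ℝ) 1, HasDerivWithinAt e (d x) (Icc 0 1) x) ∧
    (∀ x ∈ Icc (0 : ℝ) 1, HasDerivWithinAt d (V x * e x - μ * e x) (Icc 0 1) x) ∧
    d 0 = 0 ∧ d 1 = 0

/-- The eigenvalues of `-∂ₓₓ + V` with Neumann conditions, in increasing order, with a
complete orthonormal system of eigenfunctions in `L²([0,1])`. -/
structure IsNeumannEigensystem (V : ℝ → ℝ) (μ : ℕ → ℝ) (e : ℕ → ℝ → ℝ) : Prop where
  mono : Monotone μ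
  eigenpair : ∀ n, IsNeumannEigenpair V (μ n) (e n)
  orthonormal : ∀ m n, ∫ x in (0 : ℝ)..1, e m x * e n x = if m = n then 1 else 0
  complete : ∀ f : ℝ → ℝ, MemLp f 2 (volume.restrict (Icc 0 1)) →
    (∀ n, ∫ x in (0 : ℝ)..1, e n x * f x = 0) → f =ᵐ[volume.restrict (Icc 0 1)] 0

/-- `v t x` solves `∂ₜ v = ∂ₓₓ v - V v` for `t > 0`, `x ∈ [0,1]`, with Neumann conditions and
initial value `v₀`: classically for `t > 0`, and with `v(t,·) → v₀` in `L²` as `t → 0⁺`.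
Here `vx`, `vxx` are the first two space derivatives. -/
structure IsHeatSolution (V v₀ : ℝ → ℝ) (v : ℝ → ℝ → ℝ) : Prop where
  initial : ∀ x ∈ Icc (0 : ℝ) 1, v 0 x = v₀ x
  initial_tendsto :
    Tendsto (fun t => ∫ x in (0 : ℝ)..1, (v t x - v₀ x) ^ 2) (𝓝[>] 0) (𝓝 0)
  classical : ∃ vx vxx : ℝ → ℝ → ℝ,
    ContinuousOn (Function.uncurry v) (Ioi 0 ×ˢ Icc 0 1) ∧
    ContinuousOn (Function.uncurry vx) (Ioi 0 ×ˢ Icc 0 1) ∧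
    ContinuousOn (Function.uncurry vxx) (Ioi 0 ×ˢ Icc 0 1) ∧
    ∀ t > 0,
      (∀ x ∈ Icc (0 : ℝ) 1,
        HasDerivWithinAt (v t) (vx t x) (Icc 0 1) x ∧
        HasDerivWithinAt (vx t) (vxx t x) (Icc 0 1) x ∧
        HasDerivAt (fun s => v s x) (vxx t x - V x * v t x) t) ∧
      vx t 0 = 0 ∧ vx t 1 = 0

/-- The `n`-th coefficient `cₙ(f) = ∫₀¹ eₙ f`. -/
noncomputable def coeff (e : ℕ → ℝ → ℝ) (n : ℕ) (f : ℝ → ℝ) : ℝ :=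
  ∫ x in (0 : ℝ)..1, e n x * f x

/-- The norm of `L²([0,1])` (only used for continuous functions). -/
noncomputable def l2norm (f : ℝ → ℝ) : ℝ :=
  Real.sqrt (∫ x in (0 : ℝ)..1, f x ^ 2)

/-- The `n`-th term, `n = 0, 1, …`, of `∑_{k ≥ 1} (1 + μ_k) e^{-2 (μ_k - μ_0) t}`, with
`k = n + 1`. -/
noncomputable def h1Term (μ : ℕ → ℝ) (t : ℝ) (n : ℕ) : ℝ :=
  (1 + μ (n + 1)) * Real.exp (-2 * (μ (n + 1) - μ 0) * t)

/-- `h₁(t) = C₁ √(∑_{k ≥ 1} (1 + μ_k) e^{-2 (μ_k - μ_0) t})`. -/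
noncomputable def h1 (C₁ : ℝ) (μ : ℕ → ℝ) (t : ℝ) : ℝ :=
  C₁ * Real.sqrt (∑' n, h1Term μ t n)

end NeumannHeat

namespace NeumannHeat

/-! Two integrations by parts against `e n` turn the heat equation into `cₙ' = -μₙ cₙ`, so `cₙ(v(t))
= e^{-μₙ t} cₙ(v₀)`. Thus `e^{μ₀ t} v(t) - c₀(v₀) e₀` has coefficients `e^{-(μₙ-μ₀) t} cₙ(v₀)` for
`n ≥ 1` and none at `0`. Pairing with the constant `1`, Parseval (`hasSum_coeff_mul`) and
Cauchy-Schwarz give the first estimate. Evaluating the series at `x` and applying Cauchy-Schwarz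
leaves `∑ e^{-2(μₙ-μ₀) t} eₙ(x)²`, and the second estimate follows from `eₙ(x)² ≤ 2 (1 + μₙ)`.

That bound is the Sobolev inequality combined with `∫ e'² ≤ μ`, which holds as `V > 0`. The same
inequality for finite combinations (`energy_sum_le`) yields `∑ eₙ(x)² / (1 + μₙ) ≤ 2`, hence `∑ 1 /
(1 + μₙ) ≤ 2`. This replaces eigenvalue asymptotics: every series `∑ (1 + μₙ)^k e^{-μₙ t}` with `t >
0` converges, so the eigenfunction expansion may be differentiated termwise and solves the problem.
Strict decrease of `h₁` comes from `μ₀ < μ₁`, that is, from the simplicity of the eigenvalues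
(uniqueness for a linear ODE).

The eigensystem itself comes from Lax-Milgram on `H¹`, the compact embedding of `H¹` in `C([0,1])`
(Arzelà-Ascoli) and the spectral theorem for the resulting compact self-adjoint inverse. Weak
eigenfunctions are then shown to be classical. -/

/-! ### Calculus and a Sobolev inequality on `[0,1]`. -/

theorem intervalIntegrable_of_continuousOn_Icc {f : ℝ → ℝ} (hf : ContinuousOn f (Icc 0 1)) :
    IntervalIntegrable f volume 0 1 :=
  ContinuousOn.intervalIntegrable (by rwa [uIcc_of_le zero_le_one])

theorem intervalIntegrable_sub_of_continuousOn_Icc {f : ℝ → ℝ} (hf : ContinuousOn f (Icc 0 1))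
    {a b : ℝ} (ha : a ∈ Icc (0 : ℝ) 1) (hb : b ∈ Icc (0 : ℝ) 1) :
    IntervalIntegrable f volume a b :=
  ContinuousOn.intervalIntegrable (hf.mono (by
    rw [← uIcc_of_le (zero_le_one (α := ℝ))] at ha hb ⊢
    exact uIcc_subset_uIcc ha hb))

/-- Integration by parts on `[0,1]` with one-sided derivatives at the end points. -/
theorem integral_mul_deriv_Icc {u v u' v' : ℝ → ℝ}
    (hu : ∀ x ∈ Icc (0 : ℝ) 1, HasDerivWithinAt u (u' x) (Icc 0 1) x)
    (hv : ∀ x ∈ Icc (0 : ℝ) 1, HasDerivWithinAt v (v' x) (Icc 0 1) x)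
    (hu' : ContinuousOn u' (Icc 0 1)) (hv' : ContinuousOn v' (Icc 0 1)) :
    ∫ x in (0 : ℝ)..1, u x * v' x = u 1 * v 1 - u 0 * v 0 - ∫ x in (0 : ℝ)..1, u' x * v x := by
  apply intervalIntegral.integral_mul_deriv_eq_deriv_mul_of_hasDerivWithinAt
  · rwa [uIcc_of_le zero_le_one]
  · rwa [uIcc_of_le zero_le_one]
  · exact intervalIntegrable_of_continuousOn_Icc hu'
  · exact intervalIntegrable_of_continuousOn_Icc hv'

theorem continuousOn_of_hasDerivWithinAt {u u' : ℝ → ℝ}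
    (hu : ∀ x ∈ Icc (0 : ℝ) 1, HasDerivWithinAt u (u' x) (Icc 0 1) x) :
    ContinuousOn u (Icc 0 1) := fun x hx => (hu x hx).continuousWithinAt

/-- The fundamental theorem of calculus on subintervals of `[0,1]`. -/
theorem integral_deriv_Icc {u u' : ℝ → ℝ}
    (hu : ∀ x ∈ Icc (0 : ℝ) 1, HasDerivWithinAt u (u' x) (Icc 0 1) x)
    (hu' : ContinuousOn u' (Icc 0 1)) {a b : ℝ} (ha : a ∈ Icc (0 : ℝ) 1)
    (hb : b ∈ Icc (0 : ℝ) 1) :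
    ∫ x in a..b, u' x = u b - u a := by
  have hsub : uIcc a b ⊆ Icc 0 1 := by
    rw [← uIcc_of_le (zero_le_one (α := ℝ))] at ha hb ⊢
    exact uIcc_subset_uIcc ha hb
  apply intervalIntegral.integral_eq_sub_of_hasDeriv_right
  · exact (continuousOn_of_hasDerivWithinAt hu).mono hsub
  · intro x hx
    have hx1 : x ∈ Ioo (0 : ℝ) 1 :=
      ⟨lt_of_le_of_lt (le_min ha.1 hb.1) hx.1, lt_of_lt_of_le hx.2 (max_le ha.2 hb.2)⟩
    exact ((hu x (Ioo_subset_Icc_self hx1)).hasDerivAt (Icc_mem_nhds hx1.1 hx1.2)).hasDerivWithinAt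
  · exact intervalIntegrable_sub_of_continuousOn_Icc hu' ha hb

/-- A primitive of a continuous function on `[0,1]` is differentiable there. -/
theorem hasDerivWithinAt_of_eq_integral {u u' : ℝ → ℝ} {c : ℝ} (hu' : ContinuousOn u' (Icc 0 1))
    (hu : ∀ x ∈ Icc (0 : ℝ) 1, u x = c + ∫ y in (0 : ℝ)..x, u' y) :
    ∀ x ∈ Icc (0 : ℝ) 1, HasDerivWithinAt u (u' x) (Icc 0 1) x := by
  intro x hx
  -- Extending the integrand by constants makes it continuous on the whole line, so the end points
  -- need no separate treatment.
  set F : ℝ → ℝ := IccExtend zero_le_one ((Icc (0 : ℝ) 1).domRestrict u') with hF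
  have hFc : Continuous F := hu'.domRestrict.Icc_extend'
  have hFe : ∀ y ∈ Icc (0 : ℝ) 1, F y = u' y := fun y hy => by
    rw [hF, IccExtend_of_mem zero_le_one _ hy]; rfl
  have h1 : HasDerivAt (fun x => c + ∫ y in (0 : ℝ)..x, F y) (F x) x :=
    (intervalIntegral.integral_hasDerivAt_right (hFc.intervalIntegrable _ _)
      (hFc.stronglyMeasurableAtFilter _ _) hFc.continuousAt).const_add c
  rw [← hFe x hx]
  have h2 : ∀ x ∈ Icc (0 : ℝ) 1, u x = c + ∫ y in (0 : ℝ)..x, F y := by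
    intro x hx
    rw [hu x hx]
    congr 1
    apply intervalIntegral.integral_congr
    intro y hy
    rw [uIcc_of_le hx.1] at hy
    exact (hFe y ⟨hy.1, hy.2.trans hx.2⟩).symm
  exact h1.hasDerivWithinAt.congr h2 (h2 x hx)

/-- Cauchy-Schwarz for continuous functions on `[0,1]`, against the constant one. -/
theorem sq_integral_le {f : ℝ → ℝ} (hf : ContinuousOn f (Icc 0 1)) {a b : ℝ}
    (ha : a ∈ Icc (0 : ℝ) 1) (hb : b ∈ Icc (0 : ℝ) 1) :
    (∫ y in a..b, f y) ^ 2 ≤ ∫ y in (0 : ℝ)..1, f y ^ 2 := by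
  wlog hab : a ≤ b generalizing a b
  · rw [intervalIntegral.integral_symm, neg_sq]
    exact this hb ha (le_of_not_ge hab)
  have hi := intervalIntegrable_sub_of_continuousOn_Icc hf ha hb
  have hi2 := intervalIntegrable_sub_of_continuousOn_Icc (hf.fun_pow 2) ha hb
  set m := ∫ y in a..b, f y with hm
  -- Here `m` is the integral, not the mean: expanding the square gives `m² ≤ ∫ f²` because `b - a ≤
  -- 1`, with no division by `b - a`.
  have h1 : 0 ≤ ∫ y in a..b, (f y - m) ^ 2 :=
    intervalIntegral.integral_nonneg hab fun y _ => sq_nonneg _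
  have h2 : ∫ y in a..b, (f y - m) ^ 2 = (∫ y in a..b, f y ^ 2) - 2 * m * m + (b - a) * m ^ 2 := by
    have : ∀ y, (f y - m) ^ 2 = f y ^ 2 - 2 * m * f y + m ^ 2 := fun y => by ring
    simp_rw [this]
    rw [intervalIntegral.integral_add (hi2.sub (hi.const_mul _)) intervalIntegrable_const,
      intervalIntegral.integral_sub hi2 (hi.const_mul _), intervalIntegral.integral_const_mul]
    simp [hm]
  have h3 : ∫ y in a..b, f y ^ 2 ≤ ∫ y in (0 : ℝ)..1, f y ^ 2 :=
    intervalIntegral.integral_mono_interval ha.1 hab hb.2 (Eventually.of_forall fun y => sq_nonneg _)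
      (intervalIntegrable_of_continuousOn_Icc (hf.fun_pow 2))
  have h4 : (b - a) * m ^ 2 ≤ 1 * m ^ 2 :=
    mul_le_mul_of_nonneg_right (by linarith [ha.1, hb.2]) (sq_nonneg m)
  nlinarith

/-- The Sobolev inequality `‖f‖_∞² ≤ 2 ‖f‖²_{H¹}` on `[0,1]`. -/
theorem sq_le_two_mul_integral {f f' : ℝ → ℝ}
    (hf : ∀ x ∈ Icc (0 : ℝ) 1, HasDerivWithinAt f (f' x) (Icc 0 1) x)
    (hf' : ContinuousOn f' (Icc 0 1)) {x : ℝ} (hx : x ∈ Icc (0 : ℝ) 1) :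
    f x ^ 2 ≤ 2 * ((∫ y in (0 : ℝ)..1, f y ^ 2) + ∫ y in (0 : ℝ)..1, f' y ^ 2) := by
  set D := ∫ y in (0 : ℝ)..1, f' y ^ 2
  have hc := continuousOn_of_hasDerivWithinAt hf
  -- `f x` is compared with every `f y`, and the inequality is then averaged over `y`.
  have h : ∀ y ∈ Icc (0 : ℝ) 1, f x ^ 2 ≤ 2 * f y ^ 2 + 2 * D := by
    intro y hy
    have h1 := sq_integral_le hf' hy hx
    rw [integral_deriv_Icc hf hf' hy hx] at h1
    nlinarith [sq_nonneg (f x - 2 * f y)]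
  have hi := intervalIntegrable_of_continuousOn_Icc (hc.fun_pow 2)
  have := intervalIntegral.integral_mono_on (zero_le_one (α := ℝ)) (f := fun _ => f x ^ 2)
    (g := fun y => 2 * f y ^ 2 + 2 * D) (by simp) ((hi.const_mul 2).add (by simp)) h
  rw [intervalIntegral.integral_add (hi.const_mul 2) (by simp),
    intervalIntegral.integral_const_mul] at this
  simp at this
  linarith

/-! ### Energy bounds for eigenfunctions and simplicity of eigenvalues. -/

section Eigenpairs

variable {V : ℝ → ℝ}

theorem IsNeumannEigenpair.continuousOn {μ : ℝ} {e : ℝ → ℝ} (h : IsNeumannEigenpair V μ e) :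
    ContinuousOn e (Icc 0 1) := by
  obtain ⟨d, h1, -⟩ := h
  exact continuousOn_of_hasDerivWithinAt h1

variable {ι : Type*} {μ : ι → ℝ} {e : ι → ℝ → ℝ}

theorem integral_sum_mul_sum [DecidableEq ι] (hc : ∀ i, ContinuousOn (e i) (Icc 0 1))
    (ho : ∀ i j, ∫ x in (0 : ℝ)..1, e i x * e j x = if i = j then 1 else 0)
    (s : Finset ι) (a b : ι → ℝ) :
    ∫ x in (0 : ℝ)..1, (∑ i ∈ s, a i * e i x) * (∑ i ∈ s, b i * e i x) = ∑ i ∈ s, a i * b i := by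
  have h1 : ∀ x, (∑ i ∈ s, a i * e i x) * (∑ i ∈ s, b i * e i x) =
      ∑ i ∈ s, ∑ j ∈ s, (a i * b j) * (e i x * e j x) := fun x => by
    rw [Finset.sum_mul_sum]
    exact Finset.sum_congr rfl fun i _ => Finset.sum_congr rfl fun j _ => by ring
  simp_rw [h1]
  have hint : ∀ i j, IntervalIntegrable (fun x => (a i * b j) * (e i x * e j x)) volume 0 1 :=
    fun i j => (intervalIntegrable_of_continuousOn_Icc ((hc i).fun_mul (hc j))).const_mul _
  rw [intervalIntegral.integral_finsetSum
    (fun i _ => by simpa only [Finset.sum_fn] using IntervalIntegrable.sum s (fun j _ => hint i j))]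
  refine Finset.sum_congr rfl fun i hi => ?_
  rw [intervalIntegral.integral_finsetSum (fun j _ => hint i j)]
  simp [ho, hi]

/-- The energy of a finite combination of orthonormal eigenfunctions. -/
theorem energy_sum_le [DecidableEq ι] (hV : ContinuousOn V (Icc 0 1))
    (hV0 : ∀ x ∈ Icc (0 : ℝ) 1, 0 < V x)
    (hp : ∀ i, IsNeumannEigenpair V (μ i) (e i))
    (ho : ∀ i j, ∫ x in (0 : ℝ)..1, e i x * e j x = if i = j then 1 else 0)
    (s : Finset ι) (a : ι → ℝ) {x : ℝ} (hx : x ∈ Icc (0 : ℝ) 1) :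
    0 ≤ ∑ i ∈ s, μ i * a i ^ 2 ∧
    (∑ i ∈ s, a i * e i x) ^ 2 ≤ 2 * ∑ i ∈ s, (1 + μ i) * a i ^ 2 := by
  have hc := fun i => (hp i).continuousOn
  choose d hd hd' hd0 hd1 using hp
  have hdc := fun i => continuousOn_of_hasDerivWithinAt (hd' i)
  set f : ℝ → ℝ := fun x => ∑ i ∈ s, a i * e i x with hf
  set D : ℝ → ℝ := fun x => ∑ i ∈ s, a i * d i x with hD
  set L : ℝ → ℝ := fun x => ∑ i ∈ s, (μ i * a i) * e i x with hL
  have hfd : ∀ x ∈ Icc (0 : ℝ) 1, HasDerivWithinAt f (D x) (Icc 0 1) x := fun x hx =>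
    HasDerivWithinAt.fun_sum fun i _ => (hd i x hx).const_mul _
  have hDd : ∀ x ∈ Icc (0 : ℝ) 1, HasDerivWithinAt D (V x * f x - L x) (Icc 0 1) x := by
    intro x hx
    have := HasDerivWithinAt.fun_sum (u := s) fun i _ => (hd' i x hx).const_mul (a i)
    refine this.congr_deriv ?_
    simp only [hf, hL]
    rw [Finset.mul_sum, ← Finset.sum_sub_distrib]
    exact Finset.sum_congr rfl fun i _ => by ring
  have hfc := continuousOn_of_hasDerivWithinAt hfd
  have hDc := continuousOn_of_hasDerivWithinAt hDd
  have hLc : ContinuousOn L (Icc 0 1) :=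
    continuousOn_finsetSum _ fun i _ => (hc i).const_smul (μ i * a i)
  -- The Neumann conditions kill the boundary terms, leaving `∑ μᵢ aᵢ² = ∫ D² + ∫ V f²`; positivity
  -- of `V` then bounds `∫ D²` by the sum.
  have hparts := integral_mul_deriv_Icc hfd hDd hDc ((hV.mul hfc).sub hLc)
  have hD0 : D 0 = 0 := by simp [hD, hd0]
  have hD1 : D 1 = 0 := by simp [hD, hd1]
  have hfL : ∫ x in (0 : ℝ)..1, f x * L x = ∑ i ∈ s, μ i * a i ^ 2 := by
    rw [integral_sum_mul_sum hc ho]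
    exact Finset.sum_congr rfl fun i _ => by ring
  have hff : ∫ x in (0 : ℝ)..1, f x ^ 2 = ∑ i ∈ s, a i ^ 2 := by
    simp_rw [sq]; exact integral_sum_mul_sum hc ho s a a
  have hsplit : ∫ x in (0 : ℝ)..1, f x * (V x * f x - L x) =
      (∫ x in (0 : ℝ)..1, V x * f x ^ 2) - ∫ x in (0 : ℝ)..1, f x * L x := by
    rw [← intervalIntegral.integral_sub
      (intervalIntegrable_of_continuousOn_Icc (hV.fun_mul (hfc.fun_pow 2)))
      (intervalIntegrable_of_continuousOn_Icc (hfc.fun_mul hLc))]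
    exact intervalIntegral.integral_congr fun x _ => by ring
  have hVf : 0 ≤ ∫ x in (0 : ℝ)..1, V x * f x ^ 2 :=
    intervalIntegral.integral_nonneg zero_le_one fun x hx =>
      mul_nonneg (hV0 x hx).le (sq_nonneg _)
  have hDD : 0 ≤ ∫ x in (0 : ℝ)..1, D x ^ 2 :=
    intervalIntegral.integral_nonneg zero_le_one fun x hx => sq_nonneg _
  have hDD' : ∫ x in (0 : ℝ)..1, D x * D x = ∫ x in (0 : ℝ)..1, D x ^ 2 := by simp_rw [sq]
  rw [hD0, hD1, hsplit, hfL, hDD'] at hparts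
  refine ⟨by linarith, ?_⟩
  have hS := sq_le_two_mul_integral hfd hDc hx
  rw [hff] at hS
  have : ∑ i ∈ s, (1 + μ i) * a i ^ 2 = ∑ i ∈ s, a i ^ 2 + ∑ i ∈ s, μ i * a i ^ 2 := by
    rw [← Finset.sum_add_distrib]
    exact Finset.sum_congr rfl fun i _ => by ring
  rw [this]
  linarith

theorem eigenvalue_nonneg [DecidableEq ι] (hV : ContinuousOn V (Icc 0 1))
    (hV0 : ∀ x ∈ Icc (0 : ℝ) 1, 0 < V x)
    (hp : ∀ i, IsNeumannEigenpair V (μ i) (e i))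
    (ho : ∀ i j, ∫ x in (0 : ℝ)..1, e i x * e j x = if i = j then 1 else 0) (i : ι) :
    0 ≤ μ i := by
  simpa using (energy_sum_le hV hV0 hp ho {i} (fun _ => 1) (x := 0) (by simp)).1

/-- The coefficients `aᵢ = eᵢ(x) / (1 + μᵢ)` are chosen so that both sides of `energy_sum_le`
involve the same sum `S`, which gives `S² ≤ 2 S`. With a bound independent of `s`, this controls the
whole family at once. -/
theorem sum_sq_div_le [DecidableEq ι] (hV : ContinuousOn V (Icc 0 1))
    (hV0 : ∀ x ∈ Icc (0 : ℝ) 1, 0 < V x)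
    (hp : ∀ i, IsNeumannEigenpair V (μ i) (e i))
    (ho : ∀ i j, ∫ x in (0 : ℝ)..1, e i x * e j x = if i = j then 1 else 0)
    (s : Finset ι) {x : ℝ} (hx : x ∈ Icc (0 : ℝ) 1) :
    ∑ i ∈ s, e i x ^ 2 / (1 + μ i) ≤ 2 := by
  have hμ := eigenvalue_nonneg hV hV0 hp ho
  have h := (energy_sum_le hV hV0 hp ho s (fun i => e i x / (1 + μ i)) hx).2
  have h1 : ∑ i ∈ s, e i x / (1 + μ i) * e i x = ∑ i ∈ s, e i x ^ 2 / (1 + μ i) :=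
    Finset.sum_congr rfl fun i _ => by ring
  have h2 : ∑ i ∈ s, (1 + μ i) * (e i x / (1 + μ i)) ^ 2 = ∑ i ∈ s, e i x ^ 2 / (1 + μ i) :=
    Finset.sum_congr rfl fun i _ => by
      have : 1 + μ i ≠ 0 := by linarith [hμ i]
      field_simp
  rw [h1, h2] at h
  set S := ∑ i ∈ s, e i x ^ 2 / (1 + μ i)
  by_contra! hS
  nlinarith

/-- Integrating `sum_sq_div_le` over `x` replaces each `eᵢ(x)²` by `1`. This is the only information
on the growth of the eigenvalues that is needed: it gives convergence of the heat series and
discreteness of the spectrum. -/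
theorem sum_inv_le [DecidableEq ι] (hV : ContinuousOn V (Icc 0 1))
    (hV0 : ∀ x ∈ Icc (0 : ℝ) 1, 0 < V x)
    (hp : ∀ i, IsNeumannEigenpair V (μ i) (e i))
    (ho : ∀ i j, ∫ x in (0 : ℝ)..1, e i x * e j x = if i = j then 1 else 0)
    (s : Finset ι) : ∑ i ∈ s, (1 + μ i)⁻¹ ≤ 2 := by
  have hc := fun i => (hp i).continuousOn
  have hi : ∀ i, IntervalIntegrable (fun x => e i x ^ 2 / (1 + μ i)) volume 0 1 := fun i =>
    (intervalIntegrable_of_continuousOn_Icc ((hc i).fun_pow 2)).div_const _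
  have h := intervalIntegral.integral_mono_on (zero_le_one (α := ℝ)) (g := fun _ => (2 : ℝ))
    (f := fun x => ∑ i ∈ s, e i x ^ 2 / (1 + μ i))
    (by simpa only [Finset.sum_fn] using IntervalIntegrable.sum s (fun j _ => hi j))
    intervalIntegrable_const
    (fun x hx => sum_sq_div_le hV hV0 hp ho s hx)
  rw [intervalIntegral.integral_finsetSum (fun i _ => hi i)] at h
  have h1 : ∀ i, ∫ x in (0 : ℝ)..1, e i x ^ 2 / (1 + μ i) = (1 + μ i)⁻¹ := fun i => by
    have := ho i i
    simp_rw [← sq] at this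
    rw [intervalIntegral.integral_div, this]; simp
  simpa [h1] using h

theorem eigenfunction_sq_le [DecidableEq ι] (hV : ContinuousOn V (Icc 0 1))
    (hV0 : ∀ x ∈ Icc (0 : ℝ) 1, 0 < V x)
    (hp : ∀ i, IsNeumannEigenpair V (μ i) (e i))
    (ho : ∀ i j, ∫ x in (0 : ℝ)..1, e i x * e j x = if i = j then 1 else 0)
    (i : ι) {x : ℝ} (hx : x ∈ Icc (0 : ℝ) 1) : e i x ^ 2 ≤ 2 * (1 + μ i) := by
  have h := sum_sq_div_le hV hV0 hp ho {i} hx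
  have hμ := eigenvalue_nonneg hV hV0 hp ho i
  rw [Finset.sum_singleton, div_le_iff₀ (by linarith)] at h
  exact h

/-- Uniqueness for the Cauchy problem of the linear equation `y'' = q y` with zero data. -/
theorem eq_zero_of_deriv_deriv_eq_mul {q y z : ℝ → ℝ} (hq : ContinuousOn q (Icc 0 1))
    (hy : ∀ x ∈ Icc (0 : ℝ) 1, HasDerivWithinAt y (z x) (Icc 0 1) x)
    (hz : ∀ x ∈ Icc (0 : ℝ) 1, HasDerivWithinAt z (q x * y x) (Icc 0 1) x)
    (hy0 : y 0 = 0) (hz0 : z 0 = 0) : ∀ x ∈ Icc (0 : ℝ) 1, y x = 0 := by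
  obtain ⟨C, hC⟩ := isCompact_Icc.exists_bound_of_continuousOn hq
  -- Lipschitz constant, in the sup norm of `ℝ × ℝ`, of the first-order system `(y, z)' = (z, q y)`.
  set K : NNReal := max 1 (Real.toNNReal C)
  have hKC : C ≤ K := (Real.le_coe_toNNReal C).trans (by exact_mod_cast le_max_right _ _)
  have hK1 : (1 : ℝ) ≤ K := by exact_mod_cast le_max_left _ _
  have hright : ∀ t ∈ Ico (0 : ℝ) 1, Icc (0 : ℝ) 1 ∈ 𝓝[Ici t] t := fun t ht =>
    mem_of_superset (Icc_mem_nhdsGE ht.2) (Icc_subset_Icc_left ht.1)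
  have key := ODE_solution_unique_of_mem_Icc_right (a := 0) (b := 1) (K := K)
    (v := fun t (p : ℝ × ℝ) => (p.2, q t * p.1)) (s := fun _ => univ)
    (f := fun t => (y t, z t)) (g := fun _ => (0, 0)) ?_ ?_ ?_ (fun _ _ => mem_univ _)
    continuousOn_const ?_ (fun _ _ => mem_univ _) (by simp [hy0, hz0])
  · intro x hx
    exact congrArg Prod.fst (key hx)
  · intro t ht
    refine LipschitzOnWith.of_dist_le_mul fun p _ p' _ => ?_
    rw [Prod.dist_eq, Prod.dist_eq]
    have h1 : dist p.1 p'.1 ≤ max (dist p.1 p'.1) (dist p.2 p'.2) := le_max_left _ _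
    have h2 : dist p.2 p'.2 ≤ max (dist p.1 p'.1) (dist p.2 p'.2) := le_max_right _ _
    set M := max (dist p.1 p'.1) (dist p.2 p'.2)
    have hM : 0 ≤ M := dist_nonneg.trans h1
    refine max_le ?_ ?_
    · exact h2.trans (le_mul_of_one_le_left hM hK1)
    · have : dist (q t * p.1) (q t * p'.1) = |q t| * dist p.1 p'.1 := by
        rw [Real.dist_eq, Real.dist_eq, ← mul_sub, abs_mul]
      simp only [this]
      exact mul_le_mul ((hC t (Ico_subset_Icc_self ht)).trans hKC) h1 dist_nonneg K.2
  · exact (continuousOn_of_hasDerivWithinAt hy).prodMk (continuousOn_of_hasDerivWithinAt hz)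
  · intro t ht
    exact ((hy t (Ico_subset_Icc_self ht)).mono_of_mem_nhdsWithin (hright t ht)).prodMk
      ((hz t (Ico_subset_Icc_self ht)).mono_of_mem_nhdsWithin (hright t ht))
  · intro t _
    simpa using! hasDerivWithinAt_const t (Ici t) ((0 : ℝ), (0 : ℝ))

/-- The Neumann eigenvalues are simple. -/
theorem eigenvalue_injective [DecidableEq ι] (hV : ContinuousOn V (Icc 0 1))
    (hp : ∀ i, IsNeumannEigenpair V (μ i) (e i))
    (ho : ∀ i j, ∫ x in (0 : ℝ)..1, e i x * e j x = if i = j then 1 else 0) :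
    Function.Injective μ := by
  intro i j hij
  by_contra hne
  have hc := fun i => (hp i).continuousOn
  choose d hd hd' hd0 hd1 using hp
  -- A combination of the two eigenfunctions that vanishes at `0` also has zero derivative there, by
  -- the Neumann condition. It is then identically zero, which orthonormality forbids unless it is
  -- trivial.
  have hlin : ∀ a b : ℝ, a * e i 0 + b * e j 0 = 0 → a = 0 ∧ b = 0 := by
    intro a b hab
    have h0 := eq_zero_of_deriv_deriv_eq_mul (q := fun x => V x - μ i)
      (y := fun x => a * e i x + b * e j x) (z := fun x => a * d i x + b * d j x)
      (hV.sub continuousOn_const)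
      (fun x hx => ((hd i x hx).const_mul a).add ((hd j x hx).const_mul b))
      (fun x hx => (((hd' i x hx).const_mul a).add ((hd' j x hx).const_mul b)).congr_deriv
        (by rw [hij]; ring)) hab (by simp [hd0])
    have hint : ∀ k l, IntervalIntegrable (fun x => e k x * e l x) volume 0 1 := fun k l =>
      intervalIntegrable_of_continuousOn_Icc ((hc k).mul (hc l))
    have hk : ∀ k, a * (if i = k then 1 else 0) + b * (if j = k then 1 else 0) = 0 := by
      intro k
      rw [← ho i k, ← ho j k, ← intervalIntegral.integral_const_mul,
        ← intervalIntegral.integral_const_mul, ← intervalIntegral.integral_add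
          ((hint i k).const_mul a) ((hint j k).const_mul b)]
      refine (intervalIntegral.integral_congr (g := fun _ => 0) fun x hx => ?_).trans
        intervalIntegral.integral_zero
      rw [uIcc_of_le zero_le_one] at hx
      have := h0 x hx
      simp only at this ⊢
      linear_combination e k x * this
    exact ⟨by simpa [Ne.symm hne] using hk i, by simpa [hne] using hk j⟩
  -- The combination `e j 0 • e i - e i 0 • e j` vanishes at `0`, which forces `e i 0 = 0`; then `e
  -- i` alone is a forbidden combination.
  have h1 := hlin (e j 0) (-e i 0) (by ring)
  have h2 := hlin 1 0 (by simp [neg_eq_zero.1 h1.2])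
  exact one_ne_zero h2.1

end Eigenpairs

/-! ### The `L²` pairing and Parseval's identity. -/

theorem memLp_two_of_continuousOn {f : ℝ → ℝ} (hf : ContinuousOn f (Icc 0 1)) :
    MemLp f 2 (volume.restrict (Icc 0 1)) := by
  obtain ⟨C, hC⟩ := isCompact_Icc.exists_bound_of_continuousOn hf
  exact MemLp.of_bound (hf.aestronglyMeasurable measurableSet_Icc) C
    ((ae_restrict_iff' measurableSet_Icc).2 (Eventually.of_forall hC))

theorem intervalIntegral_eq_integral_restrict (f : ℝ → ℝ) :
    ∫ x in (0 : ℝ)..1, f x = ∫ x, f x ∂(volume.restrict (Icc 0 1)) := by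
  rw [intervalIntegral.integral_of_le zero_le_one, integral_Icc_eq_integral_Ioc]

theorem intervalIntegrable_iff_integrable_restrict {f : ℝ → ℝ} :
    IntervalIntegrable f volume 0 1 ↔ Integrable f (volume.restrict (Icc 0 1)) :=
  intervalIntegrable_iff_integrableOn_Icc_of_le zero_le_one

theorem inner_toLp_eq_integral {f g : ℝ → ℝ} (hf : MemLp f 2 (volume.restrict (Icc 0 1)))
    (hg : MemLp g 2 (volume.restrict (Icc 0 1))) :
    inner ℝ (hf.toLp f) (hg.toLp g) = ∫ x in (0 : ℝ)..1, f x * g x := by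
  rw [L2.inner_def, intervalIntegral_eq_integral_restrict]
  apply integral_congr_ae
  filter_upwards [hf.coeFn_toLp, hg.coeFn_toLp] with x h1 h2
  rw [h1, h2, real_inner_eq_re_inner]
  simp [mul_comm]

theorem intervalIntegrable_mul {f g : ℝ → ℝ} (hf : MemLp f 2 (volume.restrict (Icc 0 1)))
    (hg : MemLp g 2 (volume.restrict (Icc 0 1))) :
    IntervalIntegrable (fun x => f x * g x) volume 0 1 :=
  intervalIntegrable_iff_integrable_restrict.2 (hf.integrable_mul hg)

/-- Cauchy-Schwarz in `L²(0,1)`. -/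
theorem abs_integral_mul_le {f g : ℝ → ℝ} (hf : MemLp f 2 (volume.restrict (Icc 0 1)))
    (hg : MemLp g 2 (volume.restrict (Icc 0 1))) :
    |∫ x in (0 : ℝ)..1, f x * g x| ≤ l2norm f * l2norm g := by
  have h := abs_real_inner_le_norm (hf.toLp f) (hg.toLp g)
  have hn : ∀ {f : ℝ → ℝ} (hf : MemLp f 2 (volume.restrict (Icc 0 1))),
      ‖hf.toLp f‖ = l2norm f := fun {f} hf => by
    rw [norm_eq_sqrt_real_inner, inner_toLp_eq_integral, l2norm]
    simp_rw [sq]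
  rwa [inner_toLp_eq_integral, hn, hn] at h

section Basis

variable {e : ℕ → ℝ → ℝ}

theorem coeff_sub (hc : ∀ n, ContinuousOn (e n) (Icc 0 1)) {f g : ℝ → ℝ}
    (hf : MemLp f 2 (volume.restrict (Icc 0 1))) (hg : MemLp g 2 (volume.restrict (Icc 0 1)))
    (n : ℕ) : coeff e n (fun x => f x - g x) = coeff e n f - coeff e n g := by
  simp only [coeff]
  rw [← intervalIntegral.integral_sub
    (intervalIntegrable_mul (memLp_two_of_continuousOn (hc n)) hf)
    (intervalIntegrable_mul (memLp_two_of_continuousOn (hc n)) hg)]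
  simp_rw [mul_sub]

theorem coeff_const_mul (n : ℕ) (c : ℝ) (f : ℝ → ℝ) :
    coeff e n (fun x => c * f x) = c * coeff e n f := by
  simp only [coeff]
  rw [← intervalIntegral.integral_const_mul]
  congr 1; ext x; ring

/-- Parseval's identity for a complete orthonormal system of continuous functions. -/
theorem hasSum_coeff_mul (hc : ∀ n, ContinuousOn (e n) (Icc 0 1))
    (ho : ∀ m n, ∫ x in (0 : ℝ)..1, e m x * e n x = if m = n then 1 else 0)
    (hcomp : ∀ f : ℝ → ℝ, MemLp f 2 (volume.restrict (Icc 0 1)) →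
      (∀ n, ∫ x in (0 : ℝ)..1, e n x * f x = 0) → f =ᵐ[volume.restrict (Icc 0 1)] 0)
    {f g : ℝ → ℝ} (hf : MemLp f 2 (volume.restrict (Icc 0 1)))
    (hg : MemLp g 2 (volume.restrict (Icc 0 1))) :
    HasSum (fun n => coeff e n f * coeff e n g) (∫ x in (0 : ℝ)..1, f x * g x) := by
  have hm := fun n => memLp_two_of_continuousOn (hc n)
  have hon : Orthonormal ℝ (fun n => (hm n).toLp (e n)) := by
    rw [orthonormal_iff_ite]
    intro i j
    rw [inner_toLp_eq_integral, ho]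
  have hbot : (Submodule.span ℝ (range fun n => (hm n).toLp (e n)))ᗮ = ⊥ := by
    rw [Submodule.eq_bot_iff]
    intro u hu
    have h0 : ∀ n, ∫ x in (0 : ℝ)..1, e n x * u x = 0 := by
      intro n
      have := (Submodule.mem_orthogonal _ _).1 hu _ (Submodule.subset_span (mem_range_self n))
      rwa [← Lp.toLp_coeFn u (Lp.memLp u), inner_toLp_eq_integral] at this
    exact (Lp.eq_zero_iff_ae_eq_zero).2 (hcomp u (Lp.memLp u) h0)
  have h := (HilbertBasis.mkOfOrthogonalEqBot hon hbot).hasSum_inner_mul_inner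
    (hf.toLp f) (hg.toLp g)
  rw [HilbertBasis.coe_mkOfOrthogonalEqBot, inner_toLp_eq_integral] at h
  refine (congrArg (HasSum · _) (funext fun n => ?_)).mpr h
  rw [inner_toLp_eq_integral, inner_toLp_eq_integral]
  simp only [coeff, mul_comm (f _)]

theorem hasSum_coeff_sq (hc : ∀ n, ContinuousOn (e n) (Icc 0 1))
    (ho : ∀ m n, ∫ x in (0 : ℝ)..1, e m x * e n x = if m = n then 1 else 0)
    (hcomp : ∀ f : ℝ → ℝ, MemLp f 2 (volume.restrict (Icc 0 1)) →
      (∀ n, ∫ x in (0 : ℝ)..1, e n x * f x = 0) → f =ᵐ[volume.restrict (Icc 0 1)] 0)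
    {f : ℝ → ℝ} (hf : MemLp f 2 (volume.restrict (Icc 0 1))) :
    HasSum (fun n => coeff e n f ^ 2) (∫ x in (0 : ℝ)..1, f x ^ 2) := by
  simp_rw [sq]
  exact hasSum_coeff_mul hc ho hcomp hf hf

theorem coeff_sub_coeff_mul (hc : ∀ n, ContinuousOn (e n) (Icc 0 1))
    (ho : ∀ m n, ∫ x in (0 : ℝ)..1, e m x * e n x = if m = n then 1 else 0)
    {f : ℝ → ℝ} (hf : MemLp f 2 (volume.restrict (Icc 0 1))) (n : ℕ) :
    coeff e n (fun x => f x - coeff e 0 f * e 0 x) = if n = 0 then 0 else coeff e n f := by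
  rw [coeff_sub hc hf ((memLp_two_of_continuousOn (hc 0)).const_mul _), coeff_const_mul]
  have : coeff e n (e 0) = if n = 0 then 1 else 0 := ho n 0
  rw [this]
  split_ifs with h <;> simp [h]

/-- Parseval's identity for the part of `f` which is orthogonal to `e 0`. -/
theorem hasSum_coeff_succ_sq (hc : ∀ n, ContinuousOn (e n) (Icc 0 1))
    (ho : ∀ m n, ∫ x in (0 : ℝ)..1, e m x * e n x = if m = n then 1 else 0)
    (hcomp : ∀ f : ℝ → ℝ, MemLp f 2 (volume.restrict (Icc 0 1)) →
      (∀ n, ∫ x in (0 : ℝ)..1, e n x * f x = 0) → f =ᵐ[volume.restrict (Icc 0 1)] 0)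
    {f : ℝ → ℝ} (hf : MemLp f 2 (volume.restrict (Icc 0 1))) :
    HasSum (fun n => coeff e (n + 1) f ^ 2)
      (l2norm (fun x => f x - coeff e 0 f * e 0 x) ^ 2) := by
  have h := hasSum_coeff_sq hc ho hcomp
    (hf.sub ((memLp_two_of_continuousOn (hc 0)).const_mul (coeff e 0 f)))
  rw [← hasSum_nat_add_iff' 1] at h
  have h0 := coeff_sub_coeff_mul hc ho hf
  have hs : l2norm (fun x => f x - coeff e 0 f * e 0 x) ^ 2 =
      ∫ x in (0 : ℝ)..1, (f x - coeff e 0 f * e 0 x) ^ 2 :=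
    Real.sq_sqrt (intervalIntegral.integral_nonneg zero_le_one fun x _ => sq_nonneg _)
  rw [hs]
  have h00 : coeff e 0 (f - fun x => coeff e 0 f * e 0 x) = 0 := by simpa using! h0 0
  rw [Finset.sum_range_one, h00, zero_pow two_ne_zero, sub_zero] at h
  refine (congrArg (HasSum · _) (funext fun n => ?_)).mpr h
  exact congrArg (· ^ 2) (by simpa using! (h0 (n + 1)).symm)

end Basis

/-! ### Eigenfunction expansion of a solution of the heat equation. -/

/-- Termwise integration of a normally convergent series of continuous functions. -/
theorem hasSum_integral_of_bound {f : ℕ → ℝ → ℝ} {B : ℕ → ℝ} (hf : ∀ n, ContinuousOn (f n) (Icc 0 1))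
    (hB : Summable B) (hfB : ∀ n, ∀ x ∈ Icc (0 : ℝ) 1, |f n x| ≤ B n) {x : ℝ}
    (hx : x ∈ Icc (0 : ℝ) 1) :
    HasSum (fun n => ∫ y in (0 : ℝ)..x, f n y) (∫ y in (0 : ℝ)..x, ∑' n, f n y) := by
  have hsub : uIoc 0 x ⊆ Icc 0 1 := by
    rw [uIoc_of_le hx.1]
    exact fun y hy => ⟨hy.1.le, hy.2.trans hx.2⟩
  refine intervalIntegral.hasSum_integral_of_dominated_convergence (fun n _ => B n) ?_ ?_ ?_ ?_ ?_
  · exact fun n => ((hf n).mono hsub).aestronglyMeasurable measurableSet_uIoc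
  · exact fun n => Eventually.of_forall fun y hy => hfB n y (hsub hy)
  · exact Eventually.of_forall fun y _ => hB
  · exact intervalIntegrable_const
  · exact Eventually.of_forall fun y hy =>
      (Summable.of_norm_bounded hB fun n => hfB n y (hsub hy)).hasSum

/-- Cauchy-Schwarz for series. -/
theorem abs_le_mul_of_hasSum {x y : ℕ → ℝ} {S A B : ℝ} (hA : 0 ≤ A) (hB : 0 ≤ B)
    (hS : HasSum (fun n => x n * y n) S) (hx : ∀ s : Finset ℕ, ∑ n ∈ s, x n ^ 2 ≤ A ^ 2)
    (hy : ∀ s : Finset ℕ, ∑ n ∈ s, y n ^ 2 ≤ B ^ 2) : |S| ≤ A * B := by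
  refine le_of_tendsto (hS.abs) (Eventually.of_forall fun s => ?_)
  refine abs_le_of_sq_le_sq ?_ (mul_nonneg hA hB)
  refine (Finset.sum_mul_sq_le_sq_mul_sq s x y).trans ?_
  rw [mul_pow]
  exact mul_le_mul (hx s) (hy s) (Finset.sum_nonneg fun _ _ => sq_nonneg _) (sq_nonneg A)

section Expansion

variable {V : ℝ → ℝ} {μ : ℕ → ℝ} {e : ℕ → ℝ → ℝ}

theorem IsNeumannEigensystem.continuousOn (hS : IsNeumannEigensystem V μ e) (n : ℕ) :
    ContinuousOn (e n) (Icc 0 1) := (hS.eigenpair n).continuousOn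

theorem IsNeumannEigensystem.nonneg (hS : IsNeumannEigensystem V μ e)
    (hV : ContinuousOn V (Icc 0 1)) (hV0 : ∀ x ∈ Icc (0 : ℝ) 1, 0 < V x) (n : ℕ) : 0 ≤ μ n :=
  eigenvalue_nonneg hV hV0 hS.eigenpair hS.orthonormal n

/-- With `y = (1 + μ n) t`, the bound `y^(k+1) / (k+1)! ≤ e^y` dominates the term by a constant
multiple of `(1 + μ n)⁻¹`, which is summable by `sum_inv_le`. -/
theorem IsNeumannEigensystem.summable_pow_mul_exp (hS : IsNeumannEigensystem V μ e)
    (hV : ContinuousOn V (Icc 0 1)) (hV0 : ∀ x ∈ Icc (0 : ℝ) 1, 0 < V x) (k : ℕ) {t : ℝ}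
    (ht : 0 < t) : Summable fun n => (1 + μ n) ^ k * Real.exp (-μ n * t) := by
  have hμ := hS.nonneg hV hV0
  have h1 : Summable fun n => (1 + μ n)⁻¹ :=
    summable_of_sum_le (fun n => inv_nonneg.2 (by linarith [hμ n]))
      (fun s => sum_inv_le hV hV0 hS.eigenpair hS.orthonormal s)
  refine Summable.of_nonneg_of_le
    (fun n => mul_nonneg (pow_nonneg (by linarith [hμ n]) _) (Real.exp_pos _).le) (fun n => ?_)
    (h1.mul_left ((k + 1).factorial * Real.exp t / t ^ (k + 1)))
  have hn : 0 < 1 + μ n := by linarith [hμ n]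
  have h2 := Real.pow_div_factorial_le_exp ((1 + μ n) * t) (by positivity) (k + 1)
  rw [div_le_iff₀ (by positivity)] at h2
  have h3 : Real.exp (-μ n * t) = Real.exp t / Real.exp ((1 + μ n) * t) := by
    rw [← Real.exp_sub]; congr 1; ring
  rw [h3, ← div_eq_mul_inv, ← mul_div_assoc, div_div, div_le_div_iff₀ (Real.exp_pos _)
    (by positivity)]
  have h4 : (1 + μ n) ^ k * Real.exp t * (t ^ (k + 1) * (1 + μ n)) =
      Real.exp t * ((1 + μ n) * t) ^ (k + 1) := by rw [mul_pow]; ring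
  rw [h4]
  nlinarith [Real.exp_pos t]

/-- Weaker than the square root bound, but polynomial in `1 + μ n`, hence directly comparable with
`summable_pow_mul_exp`. -/
theorem IsNeumannEigensystem.abs_le (hS : IsNeumannEigensystem V μ e)
    (hV : ContinuousOn V (Icc 0 1)) (hV0 : ∀ x ∈ Icc (0 : ℝ) 1, 0 < V x) (n : ℕ) {x : ℝ}
    (hx : x ∈ Icc (0 : ℝ) 1) : |e n x| ≤ 2 * (1 + μ n) := by
  have h := eigenfunction_sq_le hV hV0 hS.eigenpair hS.orthonormal n hx
  have hμ := hS.nonneg hV hV0 n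
  exact abs_le_of_sq_le_sq (by nlinarith) (by linarith)

theorem IsNeumannEigensystem.abs_coeff_le (hS : IsNeumannEigensystem V μ e) {f : ℝ → ℝ}
    (hf : MemLp f 2 (volume.restrict (Icc 0 1))) (n : ℕ) : |coeff e n f| ≤ l2norm f := by
  have h := abs_integral_mul_le (memLp_two_of_continuousOn (hS.continuousOn n)) hf
  have h1 : l2norm (e n) = 1 := by
    have := hS.orthonormal n n
    simp_rw [← sq] at this
    simp [l2norm, this]
  rwa [h1, one_mul] at h

theorem IsNeumannEigensystem.coeff_tsum (hS : IsNeumannEigensystem V μ e) {a B : ℕ → ℝ}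
    (hB : Summable B) (haB : ∀ n, ∀ x ∈ Icc (0 : ℝ) 1, |a n * e n x| ≤ B n) (m : ℕ) :
    coeff e m (fun x => ∑' n, a n * e n x) = a m := by
  have hc := hS.continuousOn
  obtain ⟨C, hC⟩ := isCompact_Icc.exists_bound_of_continuousOn (hc m)
  have h1 := hasSum_integral_of_bound (f := fun n x => e m x * (a n * e n x))
    (B := fun n => C * B n) (fun n => (hc m).fun_mul ((hc n).const_smul (a n)))
    (hB.mul_left C) (fun n x hx => by
      rw [abs_mul]
      exact mul_le_mul (hC x hx) (haB n x hx) (abs_nonneg _)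
        ((abs_nonneg _).trans (hC x hx))) (x := 1) (by simp)
  have h2 : ∀ n, ∫ y in (0 : ℝ)..1, e m y * (a n * e n y) = if n = m then a m else 0 := by
    intro n
    have : ∀ y, e m y * (a n * e n y) = a n * (e m y * e n y) := fun y => by ring
    simp_rw [this]
    rw [intervalIntegral.integral_const_mul, hS.orthonormal]
    by_cases h : n = m
    · simp [h]
    · simp [h, Ne.symm h]
  simp_rw [h2] at h1
  have h3 := h1.unique (hasSum_ite_eq m (a m))
  simp_rw [tsum_mul_left] at h3
  exact h3

/-- A continuous function whose eigenfunction expansion converges normally is its sum. -/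
theorem IsNeumannEigensystem.hasSum_coeff_mul_of_bound (hS : IsNeumannEigensystem V μ e)
    {f : ℝ → ℝ} (hf : ContinuousOn f (Icc 0 1)) {B : ℕ → ℝ} (hB : Summable B)
    (hfB : ∀ n, ∀ x ∈ Icc (0 : ℝ) 1, |coeff e n f * e n x| ≤ B n) {x : ℝ}
    (hx : x ∈ Icc (0 : ℝ) 1) : HasSum (fun n => coeff e n f * e n x) (f x) := by
  have hc := hS.continuousOn
  set g : ℝ → ℝ := fun x => ∑' n, coeff e n f * e n x
  have hgc : ContinuousOn g (Icc 0 1) :=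
    continuousOn_tsum (fun n => (hc n).const_smul (coeff e n f)) hB hfB
  have hcg : ∀ m, coeff e m g = coeff e m f := hS.coeff_tsum hB hfB
  have hmf := memLp_two_of_continuousOn hf
  have hmg := memLp_two_of_continuousOn hgc
  -- All coefficients of `f - g` vanish, so completeness gives equality almost everywhere, and
  -- continuity gives it everywhere.
  have h0 := hS.complete (fun x => f x - g x) (hmf.sub hmg) fun n => by
    have := coeff_sub hc hmf hmg n
    rwa [hcg, sub_self] at this
  have h1 : EqOn f g (Icc 0 1) := by
    refine Measure.eqOn_Icc_of_ae_eq volume zero_ne_one ?_ hf hgc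
    filter_upwards [h0] with y hy
    exact sub_eq_zero.1 hy
  rw [h1 hx]
  exact (Summable.of_norm_bounded hB fun n => hfB n x hx).hasSum

/-- The coefficients of a solution of the heat equation satisfy `a' = -μ a`. -/
theorem IsHeatSolution.hasDerivAt_coeff (hV : ContinuousOn V (Icc 0 1)) {m : ℝ} {w : ℝ → ℝ}
    (hw : IsNeumannEigenpair V m w) {v₀ : ℝ → ℝ} {v : ℝ → ℝ → ℝ} (hv : IsHeatSolution V v₀ v)
    {t : ℝ} (ht : 0 < t) :
    HasDerivAt (fun s => ∫ x in (0 : ℝ)..1, w x * v s x) (-m * ∫ x in (0 : ℝ)..1, w x * v t x) t := by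
  obtain ⟨vx, vxx, hcv, hcx, hcxx, h⟩ := hv.classical
  have hwc := hw.continuousOn
  obtain ⟨d, hd, hd', hd0, hd1⟩ := hw
  have hdc := continuousOn_of_hasDerivWithinAt hd'
  have hslice : ∀ {u : ℝ → ℝ → ℝ}, ContinuousOn (Function.uncurry u) (Ioi 0 ×ˢ Icc 0 1) →
      ∀ s > 0, ContinuousOn (u s) (Icc 0 1) := fun {u} hu s hs =>
    hu.comp (f := fun x => (s, x)) (by fun_prop) fun x hx => ⟨hs, hx⟩
  have hF'c : ContinuousOn (fun p : ℝ × ℝ => w p.2 * (vxx p.1 p.2 - V p.2 * v p.1 p.2))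
      (Ioi 0 ×ˢ Icc 0 1) := by
    have hsnd : MapsTo (Prod.snd : ℝ × ℝ → ℝ) (Ioi 0 ×ˢ Icc 0 1) (Icc 0 1) := fun p hp => hp.2
    exact (hwc.comp continuousOn_snd hsnd).mul
      (hcxx.sub ((hV.comp continuousOn_snd hsnd).mul hcv))
  -- A compact time window away from `0`, on which the time derivative is bounded, for
  -- differentiation under the integral.
  have hsub : Icc (t / 2) (2 * t) ×ˢ Icc (0 : ℝ) 1 ⊆ Ioi 0 ×ˢ Icc 0 1 :=
    prod_mono (fun s hs => lt_of_lt_of_le (by linarith : 0 < t / 2) hs.1) subset_rfl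
  obtain ⟨C, hC⟩ := (isCompact_Icc.prod isCompact_Icc).exists_bound_of_continuousOn
    (hF'c.mono hsub)
  have hI : uIoc (0 : ℝ) 1 ⊆ Icc 0 1 := by
    rw [uIoc_of_le zero_le_one]; exact Ioc_subset_Icc_self
  have key := intervalIntegral.hasDerivAt_integral_of_dominated_loc_of_deriv_le
    (F := fun s x => w x * v s x) (F' := fun s x => w x * (vxx s x - V x * v s x))
    (x₀ := t) (s := Icc (t / 2) (2 * t)) (a := 0) (b := 1) (μ := volume) (bound := fun _ => C)
    (Icc_mem_nhds (by linarith) (by linarith))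
    ((eventually_gt_nhds ht).mono fun s hs =>
      ((hwc.mul (hslice hcv s hs)).mono hI).aestronglyMeasurable measurableSet_uIoc)
    (intervalIntegrable_of_continuousOn_Icc (hwc.fun_mul (hslice hcv t ht)))
    (((hwc.mul ((hslice hcxx t ht).sub (hV.mul (hslice hcv t ht)))).mono hI).aestronglyMeasurable
      measurableSet_uIoc)
    (Eventually.of_forall fun x hx s hs => hC (s, x) ⟨hs, hI hx⟩)
    intervalIntegrable_const
    (Eventually.of_forall fun x hx s hs => by
      have hs0 : 0 < s := lt_of_lt_of_le (by linarith) hs.1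
      exact ((h s hs0).1 x (hI hx)).2.2.const_mul (w x))
  refine key.2.congr_deriv ?_
  obtain ⟨h1, h2, h3⟩ := h t ht
  -- Two integrations by parts move `∂ₓₓ` from `v` to `w`; the boundary terms vanish by the Neumann
  -- conditions on `v` and on `w` respectively.
  have p1 := integral_mul_deriv_Icc hd (fun x hx => (h1 x hx).2.1) hdc (hslice hcxx t ht)
  have p2 := integral_mul_deriv_Icc hd' (fun x hx => (h1 x hx).1)
    ((hV.mul hwc).sub (hwc.const_smul m)) (hslice hcx t ht)
  rw [h2, h3] at p1
  rw [hd0, hd1] at p2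
  have hi1 := intervalIntegrable_of_continuousOn_Icc (hwc.fun_mul (hslice hcxx t ht))
  have hi2 := intervalIntegrable_of_continuousOn_Icc
    (hwc.fun_mul (hV.fun_mul (hslice hcv t ht)))
  have hi3 := intervalIntegrable_of_continuousOn_Icc (hwc.fun_mul (hslice hcv t ht))
  have e1 : ∫ x in (0 : ℝ)..1, w x * (vxx t x - V x * v t x) =
      (∫ x in (0 : ℝ)..1, w x * vxx t x) - ∫ x in (0 : ℝ)..1, w x * (V x * v t x) := by
    rw [← intervalIntegral.integral_sub hi1 hi2]
    simp_rw [mul_sub]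
  have e2 : ∫ x in (0 : ℝ)..1, (V x * w x - m * w x) * v t x =
      (∫ x in (0 : ℝ)..1, w x * (V x * v t x)) - m * ∫ x in (0 : ℝ)..1, w x * v t x := by
    rw [← intervalIntegral.integral_const_mul, ← intervalIntegral.integral_sub hi2
      (hi3.const_mul m)]
    congr 1; ext x; ring
  rw [e1, p1, p2, e2]
  ring

theorem IsHeatSolution.continuousOn {v₀ : ℝ → ℝ} {v : ℝ → ℝ → ℝ} (hv : IsHeatSolution V v₀ v)
    {t : ℝ} (ht : 0 < t) : ContinuousOn (v t) (Icc 0 1) := by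
  obtain ⟨vx, vxx, hcv, -⟩ := hv.classical
  exact hcv.comp (f := fun x => (t, x)) (by fun_prop) fun x hx => ⟨ht, hx⟩

theorem coeff_congr {f g : ℝ → ℝ} (h : ∀ x ∈ Icc (0 : ℝ) 1, f x = g x) (n : ℕ) :
    coeff e n f = coeff e n g :=
  intervalIntegral.integral_congr fun x hx => by
    rw [uIcc_of_le zero_le_one] at hx
    simp only [h x hx]

/-- The product `e^{μₙ s} cₙ(v(s))` is constant for `s > 0`; the `L²` convergence to `v₀` as `s →
0⁺` identifies the constant. -/
theorem IsHeatSolution.coeff_eq (hS : IsNeumannEigensystem V μ e) (hV : ContinuousOn V (Icc 0 1))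
    {v₀ : ℝ → ℝ} (hv₀ : ContinuousOn v₀ (Icc 0 1)) {v : ℝ → ℝ → ℝ} (hv : IsHeatSolution V v₀ v)
    (n : ℕ) {t : ℝ} (ht : 0 ≤ t) : coeff e n (v t) = Real.exp (-μ n * t) * coeff e n v₀ := by
  rcases ht.eq_or_lt with rfl | ht
  · simp [coeff_congr hv.initial]
  have hd : ∀ s ∈ Ioi (0 : ℝ), HasDerivAt (fun s => Real.exp (μ n * s) * coeff e n (v s)) 0 s := by
    intro s hs
    have h1 := hv.hasDerivAt_coeff hV (hS.eigenpair n) hs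
    have h2 := ((hasDerivAt_id s).const_mul (μ n)).exp
    refine (h2.mul h1).congr_deriv ?_
    simp; ring
  have hconst : ∀ s ∈ Ioi (0 : ℝ), Real.exp (μ n * s) * coeff e n (v s) =
      Real.exp (μ n * t) * coeff e n (v t) := fun s hs =>
    isOpen_Ioi.is_const_of_deriv_eq_zero isPreconnected_Ioi
      (fun s hs => (hd s hs).differentiableAt.differentiableWithinAt)
      (fun s hs => (hd s hs).deriv) hs ht
  have hlim : Tendsto (fun s => coeff e n (v s)) (𝓝[>] 0) (𝓝 (coeff e n v₀)) := by
    have h0 : Tendsto (fun s => l2norm (fun x => v s x - v₀ x)) (𝓝[>] 0) (𝓝 0) := by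
      simpa using! (Real.continuous_sqrt.tendsto 0).comp hv.initial_tendsto
    rw [tendsto_iff_norm_sub_tendsto_zero]
    refine squeeze_zero' (Eventually.of_forall fun _ => norm_nonneg _) ?_ h0
    filter_upwards [self_mem_nhdsWithin] with s hs
    have hm := memLp_two_of_continuousOn (hv.continuousOn hs)
    have hm0 := memLp_two_of_continuousOn hv₀
    rw [← coeff_sub hS.continuousOn hm hm0]
    exact hS.abs_coeff_le (hm.sub hm0) n
  have hexp : Tendsto (fun s : ℝ => Real.exp (μ n * s)) (𝓝[>] 0) (𝓝 1) := by
    have : Continuous fun s : ℝ => Real.exp (μ n * s) := by fun_prop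
    simpa using (this.tendsto 0).mono_left nhdsWithin_le_nhds
  have h1 := (hexp.mul hlim).congr' (eventually_nhdsWithin_of_forall hconst)
  have h2 := tendsto_nhds_unique h1 tendsto_const_nhds
  rw [one_mul] at h2
  rw [h2, ← mul_assoc, ← Real.exp_add]
  simp

theorem IsHeatSolution.hasSum (hS : IsNeumannEigensystem V μ e) (hV : ContinuousOn V (Icc 0 1))
    (hV0 : ∀ x ∈ Icc (0 : ℝ) 1, 0 < V x)
    {v₀ : ℝ → ℝ} (hv₀ : ContinuousOn v₀ (Icc 0 1)) {v : ℝ → ℝ → ℝ} (hv : IsHeatSolution V v₀ v)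
    {t : ℝ} (ht : 0 < t) {x : ℝ} (hx : x ∈ Icc (0 : ℝ) 1) :
    HasSum (fun n => Real.exp (-μ n * t) * coeff e n v₀ * e n x) (v t x) := by
  have hc := fun n => hv.coeff_eq hS hV hv₀ n ht.le
  have hμ := hS.nonneg hV hV0
  have h := hS.hasSum_coeff_mul_of_bound (hv.continuousOn ht)
    ((hS.summable_pow_mul_exp hV hV0 1 ht).mul_left (2 * l2norm v₀)) (fun n y hy => ?_) hx
  · simpa only [hc] using h
  · rw [hc, abs_mul, abs_mul, Real.abs_exp]
    have h1 := hS.abs_coeff_le (memLp_two_of_continuousOn hv₀) n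
    have h2 := hS.abs_le hV hV0 n hy
    have h3 := mul_le_mul h1 h2 (abs_nonneg _) (Real.sqrt_nonneg _)
    have h4 := mul_le_mul_of_nonneg_left h3 (Real.exp_pos (-μ n * t)).le
    nlinarith [h4]

end Expansion

/-! ### Properties of `h₁` and the two decay estimates. -/

section Estimates

variable {V : ℝ → ℝ} {μ : ℕ → ℝ} {e : ℕ → ℝ → ℝ}

theorem IsNeumannEigensystem.zero_lt_succ (hS : IsNeumannEigensystem V μ e)
    (hV : ContinuousOn V (Icc 0 1)) (n : ℕ) : μ 0 < μ (n + 1) :=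
  (hS.mono (Nat.zero_le _)).lt_of_ne
    ((eigenvalue_injective hV hS.eigenpair hS.orthonormal).ne (Nat.succ_ne_zero n).symm)

theorem IsNeumannEigensystem.summable_h1Term (hS : IsNeumannEigensystem V μ e)
    (hV : ContinuousOn V (Icc 0 1)) (hV0 : ∀ x ∈ Icc (0 : ℝ) 1, 0 < V x) {t : ℝ} (ht : 0 < t) :
    Summable (h1Term μ t) := by
  have h := ((summable_nat_add_iff 1).2
    (hS.summable_pow_mul_exp hV hV0 1 (mul_pos two_pos ht))).mul_left (Real.exp (2 * μ 0 * t))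
  refine h.congr fun n => ?_
  rw [h1Term, pow_one, mul_left_comm, ← Real.exp_add]
  congr 2; ring

theorem IsNeumannEigensystem.h1Term_pos (hS : IsNeumannEigensystem V μ e)
    (hV : ContinuousOn V (Icc 0 1)) (hV0 : ∀ x ∈ Icc (0 : ℝ) 1, 0 < V x) (t : ℝ) (n : ℕ) :
    0 < h1Term μ t n :=
  mul_pos (by linarith [hS.nonneg hV hV0 (n + 1)]) (Real.exp_pos _)

theorem IsNeumannEigensystem.strictAntiOn_h1 (hS : IsNeumannEigensystem V μ e)
    (hV : ContinuousOn V (Icc 0 1)) (hV0 : ∀ x ∈ Icc (0 : ℝ) 1, 0 < V x) {C : ℝ} (hC : 0 < C) :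
    StrictAntiOn (h1 C μ) (Ioi 0) := by
  intro s hs t ht hst
  refine mul_lt_mul_of_pos_left (Real.sqrt_lt_sqrt
    (tsum_nonneg fun n => (hS.h1Term_pos hV hV0 t n).le) ?_) hC
  have hlt : ∀ n, h1Term μ t n < h1Term μ s n := fun n => by
    refine mul_lt_mul_of_pos_left (Real.exp_lt_exp.2 ?_)
      (by linarith [hS.nonneg hV hV0 (n + 1)])
    have := hS.zero_lt_succ hV n
    nlinarith
  exact Summable.tsum_lt_tsum (i := 0) (fun n => (hlt n).le) (hlt 0)
    (hS.summable_h1Term hV hV0 ht) (hS.summable_h1Term hV hV0 hs)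

theorem IsNeumannEigensystem.tendsto_h1 (hS : IsNeumannEigensystem V μ e)
    (hV : ContinuousOn V (Icc 0 1)) (hV0 : ∀ x ∈ Icc (0 : ℝ) 1, 0 < V x) (C : ℝ) :
    Tendsto (h1 C μ) atTop (𝓝 0) := by
  have hgap : 0 < μ 1 - μ 0 := sub_pos.2 (hS.zero_lt_succ hV 0)
  -- For `t ≥ 1`, each term at time `t` is at most `e^{-2(μ₁-μ₀)(t-1)}` times its value at time `1`,
  -- since `μ (n + 1) ≥ μ 1`.
  have hexp : Tendsto (fun t : ℝ => Real.exp (-2 * (μ 1 - μ 0) * (t - 1)) * ∑' n, h1Term μ 1 n)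
      atTop (𝓝 0) := by
    rw [← zero_mul (∑' n, h1Term μ 1 n)]
    refine Tendsto.mul_const _ (Real.tendsto_exp_atBot.comp ?_)
    exact (tendsto_atTop_add_const_right atTop (-1 : ℝ) tendsto_id).const_mul_atTop_of_neg
      (by linarith)
  have hsum : Tendsto (fun t => ∑' n, h1Term μ t n) atTop (𝓝 0) := by
    refine squeeze_zero' (Eventually.of_forall fun t =>
      tsum_nonneg fun n => (hS.h1Term_pos hV hV0 t n).le) ?_ hexp
    filter_upwards [eventually_ge_atTop (1 : ℝ)] with t ht
    rw [← tsum_mul_left]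
    refine Summable.tsum_le_tsum (fun n => ?_) (hS.summable_h1Term hV hV0 (by linarith))
      ((hS.summable_h1Term hV hV0 one_pos).mul_left _)
    rw [h1Term, h1Term, mul_left_comm, ← Real.exp_add]
    refine mul_le_mul_of_nonneg_left (Real.exp_le_exp.2 ?_)
      (by linarith [hS.nonneg hV hV0 (n + 1)])
    have : μ 1 ≤ μ (n + 1) := hS.mono (by lia)
    nlinarith
  simpa [h1] using! (hsum.sqrt).const_mul C

theorem IsNeumannEigensystem.abs_mean_sub_le (hS : IsNeumannEigensystem V μ e)
    (hV : ContinuousOn V (Icc 0 1)) {v₀ : ℝ → ℝ} (hv₀ : ContinuousOn v₀ (Icc 0 1))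
    {v : ℝ → ℝ → ℝ} (hv : IsHeatSolution V v₀ v) {t : ℝ} (ht : 0 ≤ t) :
    |Real.exp (μ 0 * t) * (∫ ξ in (0 : ℝ)..1, v t ξ) - coeff e 0 v₀ * ∫ ξ in (0 : ℝ)..1, e 0 ξ| ≤
      Real.exp (-(μ 1 - μ 0) * t) * l2norm (fun x => v₀ x - coeff e 0 v₀ * e 0 x) *
        l2norm (fun x => 1 - coeff e 0 (fun _ => 1) * e 0 x) := by
  have hvt : ContinuousOn (v t) (Icc 0 1) := by
    rcases ht.eq_or_lt with rfl | ht
    · exact hv₀.congr hv.initial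
    · exact hv.continuousOn ht
  have h1m : MemLp (fun _ : ℝ => (1 : ℝ)) 2 (volume.restrict (Icc 0 1)) :=
    memLp_two_of_continuousOn continuousOn_const
  have hm0 := memLp_two_of_continuousOn hv₀
  have hP := (hasSum_coeff_mul hS.continuousOn hS.orthonormal hS.complete
    (memLp_two_of_continuousOn hvt) h1m).mul_left (Real.exp (μ 0 * t))
  simp_rw [hv.coeff_eq hS hV hv₀ _ ht, mul_one] at hP
  rw [← hasSum_nat_add_iff' 1, Finset.sum_range_one] at hP
  have h0 : Real.exp (μ 0 * t) * (Real.exp (-μ 0 * t) * coeff e 0 v₀ * coeff e 0 fun _ => 1) =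
      coeff e 0 v₀ * ∫ ξ in (0 : ℝ)..1, e 0 ξ := by
    rw [mul_assoc, ← mul_assoc, ← Real.exp_add]
    simp [coeff]
  rw [h0] at hP
  have hB1 := hasSum_coeff_succ_sq hS.continuousOn hS.orthonormal hS.complete hm0
  have hB2 := hasSum_coeff_succ_sq hS.continuousOn hS.orthonormal hS.complete h1m
  refine abs_le_mul_of_hasSum (mul_nonneg (Real.exp_pos _).le (Real.sqrt_nonneg _))
    (Real.sqrt_nonneg _)
    -- The exponentials go with the coefficients of `v₀`, where the largest of them, the one for `μ
    -- 1`, factors out.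
    (x := fun n => Real.exp (-(μ (n + 1) - μ 0) * t) * coeff e (n + 1) v₀)
    (y := fun n => coeff e (n + 1) fun _ => 1) ?_ (fun s => ?_)
    (fun s => sum_le_hasSum s (fun n _ => sq_nonneg _) hB2)
  · refine (congrArg (HasSum · _) (funext fun n => ?_)).mpr hP
    have : Real.exp (-(μ (n + 1) - μ 0) * t) =
        Real.exp (μ 0 * t) * Real.exp (-μ (n + 1) * t) := by
      rw [← Real.exp_add]; congr 1; ring
    rw [this]; ring
  · rw [mul_pow]
    refine le_trans ?_ (mul_le_mul_of_nonneg_left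
      (sum_le_hasSum s (fun n _ => sq_nonneg _) hB1) (sq_nonneg _))
    rw [Finset.mul_sum]
    refine Finset.sum_le_sum fun n _ => ?_
    rw [mul_pow]
    refine mul_le_mul_of_nonneg_right (pow_le_pow_left₀ (Real.exp_pos _).le
      (Real.exp_le_exp.2 ?_) 2) (sq_nonneg _)
    have : μ 1 ≤ μ (n + 1) := hS.mono (by lia)
    nlinarith

theorem IsNeumannEigensystem.abs_sub_le_h1 (hS : IsNeumannEigensystem V μ e)
    (hV : ContinuousOn V (Icc 0 1)) (hV0 : ∀ x ∈ Icc (0 : ℝ) 1, 0 < V x)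
    {v₀ : ℝ → ℝ} (hv₀ : ContinuousOn v₀ (Icc 0 1))
    {v : ℝ → ℝ → ℝ} (hv : IsHeatSolution V v₀ v) {t : ℝ} (ht : 0 < t) {x : ℝ}
    (hx : x ∈ Icc (0 : ℝ) 1) :
    |Real.exp (μ 0 * t) * v t x - coeff e 0 v₀ * e 0 x| ≤
      l2norm (fun x => v₀ x - coeff e 0 v₀ * e 0 x) * h1 (Real.sqrt 2) μ t := by
  have hP := (hv.hasSum hS hV hV0 hv₀ ht hx).mul_left (Real.exp (μ 0 * t))
  rw [← hasSum_nat_add_iff' 1, Finset.sum_range_one] at hP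
  have h0 : Real.exp (μ 0 * t) * (Real.exp (-μ 0 * t) * coeff e 0 v₀ * e 0 x) =
      coeff e 0 v₀ * e 0 x := by
    rw [mul_assoc, ← mul_assoc, ← Real.exp_add]
    simp
  rw [h0] at hP
  have hB1 := hasSum_coeff_succ_sq hS.continuousOn hS.orthonormal hS.complete
    (memLp_two_of_continuousOn hv₀)
  have hnn := fun n => (hS.h1Term_pos hV hV0 t n).le
  refine abs_le_mul_of_hasSum (Real.sqrt_nonneg _)
    (mul_nonneg (Real.sqrt_nonneg _) (Real.sqrt_nonneg _))
    -- Here the exponentials go with `e (n + 1) x`: the squares of the other factor sum to the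
    -- squared `L²` norm, and this one produces `h1Term` through `eigenfunction_sq_le`.
    (x := fun n => coeff e (n + 1) v₀)
    (y := fun n => Real.exp (-(μ (n + 1) - μ 0) * t) * e (n + 1) x) ?_
    (fun s => sum_le_hasSum s (fun n _ => sq_nonneg _) hB1) (fun s => ?_)
  · refine (congrArg (HasSum · _) (funext fun n => ?_)).mpr hP
    have : Real.exp (-(μ (n + 1) - μ 0) * t) =
        Real.exp (μ 0 * t) * Real.exp (-μ (n + 1) * t) := by
      rw [← Real.exp_add]; congr 1; ring
    rw [this]; ring
  · rw [h1, mul_pow, Real.sq_sqrt zero_le_two, Real.sq_sqrt (tsum_nonneg hnn)]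
    refine le_trans ?_ (mul_le_mul_of_nonneg_left
      ((hS.summable_h1Term hV hV0 ht).sum_le_tsum s fun n _ => hnn n) zero_le_two)
    rw [Finset.mul_sum]
    refine Finset.sum_le_sum fun n _ => ?_
    have h2 := eigenfunction_sq_le hV hV0 hS.eigenpair hS.orthonormal (n + 1) hx
    have h3 : Real.exp (-(μ (n + 1) - μ 0) * t) ^ 2 =
        Real.exp (-2 * (μ (n + 1) - μ 0) * t) := by
      rw [← Real.exp_nat_mul]; congr 1; push_cast; ring
    rw [mul_pow, h3, h1Term]
    nlinarith [mul_le_mul_of_nonneg_left h2 (Real.exp_pos (-2 * (μ (n + 1) - μ 0) * t)).le]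

end Estimates

/-! ### Existence for the heat equation by the eigenfunction series. -/

/-- Termwise differentiation of a series on `[0,1]`, end points included. -/
theorem hasDerivWithinAt_tsum_Icc {f f' : ℕ → ℝ → ℝ} {B : ℕ → ℝ}
    (hf : ∀ n, ∀ x ∈ Icc (0 : ℝ) 1, HasDerivWithinAt (f n) (f' n x) (Icc 0 1) x)
    (hf' : ∀ n, ContinuousOn (f' n) (Icc 0 1)) (hB : Summable B)
    (hfB : ∀ n, ∀ x ∈ Icc (0 : ℝ) 1, |f' n x| ≤ B n)
    (hs : ∀ x ∈ Icc (0 : ℝ) 1, Summable fun n => f n x) :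
    ∀ x ∈ Icc (0 : ℝ) 1,
      HasDerivWithinAt (fun x => ∑' n, f n x) (∑' n, f' n x) (Icc 0 1) x := by
  refine hasDerivWithinAt_of_eq_integral (c := ∑' n, f n 0) (continuousOn_tsum hf' hB hfB) ?_
  intro x hx
  have h0 : (0 : ℝ) ∈ Icc (0 : ℝ) 1 := by simp
  have h := hasSum_integral_of_bound hf' hB hfB hx
  rw [← h.tsum_eq, ← (hs 0 h0).tsum_add h.summable]
  refine tsum_congr fun n => ?_
  rw [integral_deriv_Icc (hf n) (hf' n) h0 hx]
  ring

section HeatSeries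

variable {V : ℝ → ℝ} {μ : ℕ → ℝ} {e : ℕ → ℝ → ℝ}

theorem IsNeumannEigensystem.summable_heat_bound (hS : IsNeumannEigensystem V μ e)
    (hV : ContinuousOn V (Icc 0 1)) (hV0 : ∀ x ∈ Icc (0 : ℝ) 1, 0 < V x) (N K : ℝ) (k : ℕ)
    {t : ℝ} (ht : 0 < t) :
    Summable fun n => Real.exp (-μ n * t) * N * (K * (1 + μ n) ^ k) :=
  ((hS.summable_pow_mul_exp hV hV0 k ht).mul_left (N * K)).congr fun n => by ring

/-- One majorant, valid for all times `t ≥ s`, serves the series of `v` and of all its derivatives;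
only the power `k` and the constant `K` change. -/
theorem IsNeumannEigensystem.abs_heat_term_le (hS : IsNeumannEigensystem V μ e)
    (hV : ContinuousOn V (Icc 0 1)) (hV0 : ∀ x ∈ Icc (0 : ℝ) 1, 0 < V x) {c : ℕ → ℝ} {N K : ℝ}
    {k : ℕ} (hc : ∀ n, |c n| ≤ N) {s t y : ℝ} {n : ℕ} (hst : s ≤ t)
    (hy : |y| ≤ K * (1 + μ n) ^ k) :
    |Real.exp (-μ n * t) * c n * y| ≤ Real.exp (-μ n * s) * N * (K * (1 + μ n) ^ k) := by
  rw [abs_mul, abs_mul, Real.abs_exp]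
  have hN := (abs_nonneg _).trans (hc n)
  refine mul_le_mul (mul_le_mul (Real.exp_le_exp.2 ?_) (hc n) (abs_nonneg _) (Real.exp_pos _).le)
    hy (abs_nonneg _) (mul_nonneg (Real.exp_pos _).le hN)
  nlinarith [hS.nonneg hV hV0 n]

theorem IsNeumannEigensystem.continuousOn_heat_series (hS : IsNeumannEigensystem V μ e)
    (hV : ContinuousOn V (Icc 0 1)) (hV0 : ∀ x ∈ Icc (0 : ℝ) 1, 0 < V x) {c : ℕ → ℝ} {N K : ℝ}
    {k : ℕ} (hc : ∀ n, |c n| ≤ N) {w : ℕ → ℝ → ℝ} (hw : ∀ n, ContinuousOn (w n) (Icc 0 1))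
    (hwK : ∀ n, ∀ x ∈ Icc (0 : ℝ) 1, |w n x| ≤ K * (1 + μ n) ^ k) :
    ContinuousOn (Function.uncurry fun t x => ∑' n, Real.exp (-μ n * t) * c n * w n x)
      (Ioi 0 ×ˢ Icc 0 1) := by
  refine continuousOn_of_locally_continuousOn fun p hp => ?_
  have hp1 : 0 < p.1 := hp.1
  refine ⟨Ioi (p.1 / 2) ×ˢ univ, isOpen_Ioi.prod isOpen_univ,
    ⟨half_lt_self hp1, mem_univ _⟩, ?_⟩
  refine continuousOn_tsum (fun n => ?_) (hS.summable_heat_bound hV hV0 N K k (half_pos hp1))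
    (fun n q hq => hS.abs_heat_term_le hV hV0 hc (le_of_lt hq.2.1) (hwK n q.2 hq.1.2))
  have h1 : ContinuousOn (fun q : ℝ × ℝ => w n q.2) ((Ioi 0 ×ˢ Icc 0 1) ∩ Ioi (p.1 / 2) ×ˢ univ) :=
    (hw n).comp continuousOn_snd fun q hq => hq.1.2
  exact ContinuousOn.mul (by fun_prop) h1

theorem IsNeumannEigensystem.hasDerivAt_heat_series (hS : IsNeumannEigensystem V μ e)
    (hV : ContinuousOn V (Icc 0 1)) (hV0 : ∀ x ∈ Icc (0 : ℝ) 1, 0 < V x) {c : ℕ → ℝ} {N : ℝ}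
    (hc : ∀ n, |c n| ≤ N) {x : ℝ} (hx : x ∈ Icc (0 : ℝ) 1) {t : ℝ} (ht : 0 < t) :
    HasDerivAt (fun s => ∑' n, Real.exp (-μ n * s) * c n * e n x)
      (∑' n, Real.exp (-μ n * t) * c n * (-μ n * e n x)) t := by
  have hμ := hS.nonneg hV hV0
  refine hasDerivAt_tsum_of_isPreconnected
    (g := fun n s => Real.exp (-μ n * s) * c n * e n x)
    (g' := fun n s => Real.exp (-μ n * s) * c n * (-μ n * e n x))
    (t := Ioi (t / 2)) (y₀ := t)
    (hS.summable_heat_bound hV hV0 N 2 2 (half_pos ht)) isOpen_Ioi isPreconnected_Ioi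
    (fun n s _ => ?_) (fun n s hs => ?_) (half_lt_self ht) ?_ (half_lt_self ht)
  · have := (((hasDerivAt_id s).const_mul (-μ n)).exp.mul_const (c n)).mul_const (e n x)
    refine this.congr_deriv ?_
    simp; ring
  · refine hS.abs_heat_term_le hV hV0 hc (le_of_lt hs) ?_
    rw [abs_mul, abs_neg, abs_of_nonneg (hμ n)]
    nlinarith [hS.abs_le hV hV0 n hx, hμ n, abs_nonneg (e n x)]
  · exact Summable.of_norm_bounded (hS.summable_heat_bound hV hV0 N 2 1 ht) fun n =>
      hS.abs_heat_term_le hV hV0 hc le_rfl (by simpa using hS.abs_le hV hV0 n hx)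

/-- The heat equation with a square integrable initial value is solved by the eigenfunction
expansion. -/
theorem IsNeumannEigensystem.exists_isHeatSolution (hS : IsNeumannEigensystem V μ e)
    (hV : ContinuousOn V (Icc 0 1)) (hV0 : ∀ x ∈ Icc (0 : ℝ) 1, 0 < V x) {v₀ : ℝ → ℝ}
    (hm0 : MemLp v₀ 2 (volume.restrict (Icc 0 1))) :
    ∃ v : ℝ → ℝ → ℝ, IsHeatSolution V v₀ v := by
  have hμ := hS.nonneg hV hV0
  have hec := hS.continuousOn
  have heb := fun n x (hx : x ∈ Icc (0 : ℝ) 1) => hS.abs_le hV hV0 n hx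
  have hcN := hS.abs_coeff_le hm0
  set c : ℕ → ℝ := fun n => coeff e n v₀
  set N := l2norm v₀
  choose d hd hd' hd0 hd1 using hS.eigenpair
  have hdc := fun n => continuousOn_of_hasDerivWithinAt (hd' n)
  obtain ⟨M, hM⟩ := isCompact_Icc.exists_bound_of_continuousOn hV
  have hM0 : 0 ≤ M := (abs_nonneg _).trans (hM 0 (by simp))
  -- `q n` is the second derivative of `e n`.
  set q : ℕ → ℝ → ℝ := fun n x => V x * e n x - μ n * e n x with hq
  have hqc : ∀ n, ContinuousOn (q n) (Icc 0 1) := fun n =>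
    (hV.mul (hec n)).sub ((hec n).const_smul (μ n))
  have hqb : ∀ n, ∀ x ∈ Icc (0 : ℝ) 1, |q n x| ≤ (2 * (M + 1)) * (1 + μ n) ^ 2 := by
    intro n x hx
    have h1 : |V x - μ n| ≤ M + μ n := (abs_sub _ _).trans
      (add_le_add (hM x hx) (abs_of_nonneg (hμ n)).le)
    have h2 : q n x = (V x - μ n) * e n x := by simp only [hq]; ring
    rw [h2, abs_mul]
    refine (mul_le_mul h1 (heb n x hx) (abs_nonneg _) (by linarith [hμ n])).trans ?_
    nlinarith [hμ n, mul_nonneg hM0 (hμ n), mul_nonneg (hμ n) (hμ n),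
      mul_nonneg hM0 (mul_nonneg (hμ n) (hμ n))]
  -- Since `d n 0 = 0`, the first derivative is the integral of `q n` and inherits its bound.
  have hdb : ∀ n, ∀ x ∈ Icc (0 : ℝ) 1, |d n x| ≤ (2 * (M + 1)) * (1 + μ n) ^ 2 := by
    intro n x hx
    have h1 := integral_deriv_Icc (hd' n) (hqc n) (a := 0) (by simp) hx
    rw [hd0, sub_zero] at h1
    rw [← h1]
    have h2 := intervalIntegral.norm_integral_le_of_norm_le_const (f := q n) (a := 0) (b := x)
      (C := (2 * (M + 1)) * (1 + μ n) ^ 2) fun y hy => by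
        rw [uIoc_of_le hx.1] at hy
        exact hqb n y ⟨hy.1.le, hy.2.trans hx.2⟩
    refine h2.trans ?_
    rw [sub_zero, abs_of_nonneg hx.1]
    exact mul_le_of_le_one_right (mul_nonneg (by linarith) (sq_nonneg _)) hx.2
  have heb' : ∀ n, ∀ x ∈ Icc (0 : ℝ) 1, |e n x| ≤ 2 * (1 + μ n) ^ 1 := fun n x hx => by
    simpa using heb n x hx
  have hsum : ∀ {w : ℕ → ℝ → ℝ} {K : ℝ} {k : ℕ},
      (∀ n, ∀ x ∈ Icc (0 : ℝ) 1, |w n x| ≤ K * (1 + μ n) ^ k) → ∀ t > 0, ∀ x ∈ Icc (0 : ℝ) 1,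
      Summable fun n => Real.exp (-μ n * t) * c n * w n x := fun {w K k} hw t ht x hx =>
    Summable.of_norm_bounded (hS.summable_heat_bound hV hV0 N K k ht) fun n =>
      hS.abs_heat_term_le hV hV0 hcN le_rfl (hw n x hx)
  set u : ℝ → ℝ → ℝ := fun t x => ∑' n, Real.exp (-μ n * t) * c n * e n x with hu
  -- The initial value is imposed by hand, as the pointwise bounds on the series hold only for `t >
  -- 0`.
  set v : ℝ → ℝ → ℝ := fun t x => if t = 0 then v₀ x else u t x with hv
  have hvu : ∀ t > 0, v t = u t := fun t ht => by
    funext x; simp only [hv, if_neg (ne_of_gt ht)]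
  have huc := hS.continuousOn_heat_series hV hV0 hcN hec heb'
  refine ⟨v, fun x _ => by simp [hv], ?_, fun t x => ∑' n, Real.exp (-μ n * t) * c n * d n x,
    fun t x => ∑' n, Real.exp (-μ n * t) * c n * q n x, ?_,
    hS.continuousOn_heat_series hV hV0 hcN hdc hdb,
    hS.continuousOn_heat_series hV hV0 hcN hqc hqb, fun t ht => ⟨fun x hx => ⟨?_, ?_, ?_⟩, ?_, ?_⟩⟩
  -- By Parseval, `‖u(t) - v₀‖² = ∑ (e^{-μₙ t} - 1)² cₙ²`, which is dominated by `∑ cₙ²` and tends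
  -- to `0` termwise.
  · have hsq := hasSum_coeff_sq hec hS.orthonormal hS.complete hm0
    have hlim : Tendsto (fun t => ∑' n, ((Real.exp (-μ n * t) - 1) * c n) ^ 2) (𝓝[>] 0)
        (𝓝 (∑' _ : ℕ, 0)) := by
      refine tendsto_tsum_of_dominated_convergence hsq.summable (fun n => ?_) ?_
      · have : Continuous fun t : ℝ => ((Real.exp (-μ n * t) - 1) * c n) ^ 2 := by fun_prop
        simpa using (this.tendsto 0).mono_left nhdsWithin_le_nhds
      · filter_upwards [self_mem_nhdsWithin] with t (ht : 0 < t) n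
        rw [Real.norm_of_nonneg (sq_nonneg _), mul_pow]
        refine mul_le_of_le_one_left (sq_nonneg _) ?_
        have h1 : Real.exp (-μ n * t) ≤ 1 := Real.exp_le_one_iff.2 (by nlinarith [hμ n])
        nlinarith [Real.exp_pos (-μ n * t)]
    rw [tsum_zero] at hlim
    refine hlim.congr' ?_
    filter_upwards [self_mem_nhdsWithin] with t (ht : 0 < t)
    have hut : ContinuousOn (u t) (Icc 0 1) :=
      huc.comp (f := fun x => (t, x)) (by fun_prop) fun x hx => ⟨ht, hx⟩
    have hmu := memLp_two_of_continuousOn hut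
    rw [hvu t ht]
    have h := hasSum_coeff_sq hec hS.orthonormal hS.complete (hmu.sub hm0)
    refine Eq.trans (tsum_congr fun n => ?_) h.tsum_eq
    have h1 : coeff e n (u t) = Real.exp (-μ n * t) * c n :=
      hS.coeff_tsum (hS.summable_heat_bound hV hV0 N 2 1 ht)
        (fun n x hx => hS.abs_heat_term_le hV hV0 hcN le_rfl (heb' n x hx)) n
    have h2 : coeff e n (u t - v₀) = coeff e n (u t) - c n := coeff_sub hec hmu hm0 n
    rw [h2, h1]; ring
  · exact huc.congr fun p hp => congrFun (hvu p.1 hp.1) p.2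
  · rw [hvu t ht]
    exact hasDerivWithinAt_tsum_Icc (fun n x hx => (hd n x hx).const_mul _)
      (fun n => (hdc n).const_smul (Real.exp (-μ n * t) * c n))
      (hS.summable_heat_bound hV hV0 N _ 2 ht)
      (fun n x hx => hS.abs_heat_term_le hV hV0 hcN le_rfl (hdb n x hx))
      (hsum heb' t ht) x hx
  · exact hasDerivWithinAt_tsum_Icc (fun n x hx => (hd' n x hx).const_mul _)
      (fun n => (hqc n).const_smul (Real.exp (-μ n * t) * c n))
      (hS.summable_heat_bound hV hV0 N _ 2 ht)
      (fun n x hx => hS.abs_heat_term_le hV hV0 hcN le_rfl (hqb n x hx))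
      (hsum hdb t ht) x hx
  · have h1 := hS.hasDerivAt_heat_series hV hV0 hcN hx ht
    have h2 : (fun s => v s x) =ᶠ[𝓝 t] fun s => u s x := by
      filter_upwards [eventually_gt_nhds ht] with s hs
      rw [hvu s hs]
    refine (h1.congr_of_eventuallyEq h2).congr_deriv ?_
    rw [hvu t ht]
    simp only [hu]
    rw [← tsum_mul_left, ← (hsum hqb t ht x hx).tsum_sub ((hsum heb' t ht x hx).mul_left (V x))]
    refine tsum_congr fun n => ?_
    simp only [hq]; ring
  · simp [hd0]
  · simp [hd1]

end HeatSeries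

/-! ### The space `H¹(0,1)` and its compact embedding. -/

/-- The Hilbert space `L²([0,1])`. -/
abbrev L2Space : Type := Lp ℝ 2 (volume.restrict (Icc (0 : ℝ) 1))

/-- The Sobolev space `H¹(0,1)`, a function being represented by its value at `0` and its weak
derivative. -/
abbrev H1Space : Type := WithLp 2 (ℝ × L2Space)

/-- The function represented by an element of `H1Space`. -/
noncomputable def H1Space.toFun (p : H1Space) (x : ℝ) : ℝ :=
  p.fst + ∫ y in (0 : ℝ)..x, p.snd y

theorem L2Space.intervalIntegrable (w : L2Space) {a b : ℝ} (ha : a ∈ Icc (0 : ℝ) 1)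
    (hb : b ∈ Icc (0 : ℝ) 1) : IntervalIntegrable w volume a b := by
  have h : IntervalIntegrable w volume 0 1 :=
    intervalIntegrable_iff_integrable_restrict.2 ((Lp.memLp w).integrable (by norm_num))
  refine h.mono_set ?_
  rw [← uIcc_of_le (zero_le_one (α := ℝ))] at ha hb
  exact uIcc_subset_uIcc ha hb

theorem L2Space.abs_integral_le (w : L2Space) {a b : ℝ} (ha : a ∈ Icc (0 : ℝ) 1)
    (hb : b ∈ Icc (0 : ℝ) 1) : |∫ y in a..b, w y| ≤ Real.sqrt |b - a| * ‖w‖ := by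
  wlog hab : a ≤ b generalizing a b
  · rw [intervalIntegral.integral_symm, abs_neg, abs_sub_comm]
    exact this hb ha (le_of_not_ge hab)
  have hsub : Ioc a b ⊆ Icc 0 1 := fun y hy => ⟨ha.1.trans hy.1.le, hy.2.trans hb.2⟩
  have hfin : (volume.restrict (Icc (0 : ℝ) 1)) (Ioc a b) ≠ ⊤ := measure_ne_top _ _
  have h1 := L2.inner_indicatorConstLp_one (𝕜 := ℝ) measurableSet_Ioc hfin w
  rw [Measure.restrict_restrict measurableSet_Ioc, inter_eq_left.2 hsub] at h1
  rw [intervalIntegral.integral_of_le hab, ← h1]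
  refine (abs_real_inner_le_norm _ _).trans (mul_le_mul_of_nonneg_right ?_ (norm_nonneg _))
  refine norm_indicatorConstLp_le.trans_eq ?_
  rw [measureReal_restrict_apply measurableSet_Ioc, inter_eq_left.2 hsub,
    Real.volume_real_Ioc_of_le hab, Real.sqrt_eq_rpow, abs_of_nonneg (sub_nonneg.2 hab)]
  simp

theorem H1Space.toFun_sub (p : H1Space) {a b : ℝ} (ha : a ∈ Icc (0 : ℝ) 1)
    (hb : b ∈ Icc (0 : ℝ) 1) : p.toFun b - p.toFun a = ∫ y in a..b, p.snd y := by
  have h0 : (0 : ℝ) ∈ Icc (0 : ℝ) 1 := by simp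
  rw [toFun, toFun, add_sub_add_left_eq_sub, intervalIntegral.integral_interval_sub_left
    (p.snd.intervalIntegrable h0 hb) (p.snd.intervalIntegrable h0 ha)]

theorem H1Space.abs_fst_le (p : H1Space) : |p.fst| ≤ ‖p‖ := by
  refine abs_le_of_sq_le_sq ?_ (norm_nonneg _)
  rw [WithLp.prod_norm_sq_eq_of_L2, Real.norm_eq_abs, sq_abs]
  nlinarith [sq_nonneg ‖p.snd‖]

theorem H1Space.norm_snd_le (p : H1Space) : ‖p.snd‖ ≤ ‖p‖ := by
  refine le_of_sq_le_sq ?_ (norm_nonneg _)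
  rw [WithLp.prod_norm_sq_eq_of_L2]
  nlinarith [sq_nonneg ‖p.fst‖]

/-- The Hölder modulus of exponent `1/2`, uniform on bounded sets: the equicontinuity needed for
Arzelà-Ascoli. -/
theorem H1Space.abs_toFun_sub_le (p : H1Space) {a b : ℝ} (ha : a ∈ Icc (0 : ℝ) 1)
    (hb : b ∈ Icc (0 : ℝ) 1) : |p.toFun b - p.toFun a| ≤ Real.sqrt |b - a| * ‖p‖ := by
  rw [p.toFun_sub ha hb]
  exact (p.snd.abs_integral_le ha hb).trans
    (mul_le_mul_of_nonneg_left p.norm_snd_le (Real.sqrt_nonneg _))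

theorem H1Space.toFun_zero (p : H1Space) : p.toFun 0 = p.fst := by simp [toFun]

theorem H1Space.abs_toFun_sub_fst_le (p : H1Space) {x : ℝ} (hx : x ∈ Icc (0 : ℝ) 1) :
    |p.toFun x - p.fst| ≤ ‖p.snd‖ := by
  have h0 : (0 : ℝ) ∈ Icc (0 : ℝ) 1 := by simp
  rw [← p.toFun_zero, p.toFun_sub h0 hx]
  refine (p.snd.abs_integral_le h0 hx).trans (mul_le_of_le_one_left (norm_nonneg _) ?_)
  rw [Real.sqrt_le_one, sub_zero, abs_of_nonneg hx.1]
  exact hx.2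

theorem H1Space.abs_toFun_le (p : H1Space) {x : ℝ} (hx : x ∈ Icc (0 : ℝ) 1) :
    |p.toFun x| ≤ 2 * ‖p‖ := by
  have h1 := p.abs_toFun_sub_fst_le hx
  have h2 := abs_add_le (p.toFun x - p.fst) p.fst
  rw [sub_add_cancel] at h2
  linarith [p.abs_fst_le, p.norm_snd_le]

theorem H1Space.continuousOn_toFun (p : H1Space) : ContinuousOn p.toFun (Icc 0 1) := by
  have h := (p.snd.intervalIntegrable (a := 0) (b := 1) (by simp) (by simp))
  have := intervalIntegral.continuousOn_primitive_interval (f := p.snd) (a := 0) (b := 1)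
    (μ := volume) (by
      rw [uIcc_of_le zero_le_one]
      exact (intervalIntegrable_iff_integrable_restrict.1 h))
  rw [uIcc_of_le zero_le_one] at this
  exact continuousOn_const.add this

theorem H1Space.toFun_add (p q : H1Space) {x : ℝ} (hx : x ∈ Icc (0 : ℝ) 1) :
    (p + q).toFun x = p.toFun x + q.toFun x := by
  have h0 : (0 : ℝ) ∈ Icc (0 : ℝ) 1 := by simp
  have h : ∫ y in (0 : ℝ)..x, (p.snd + q.snd) y =
      (∫ y in (0 : ℝ)..x, p.snd y) + ∫ y in (0 : ℝ)..x, q.snd y := by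
    rw [← intervalIntegral.integral_add (p.snd.intervalIntegrable h0 hx)
      (q.snd.intervalIntegrable h0 hx)]
    refine intervalIntegral.integral_congr_ae_restrict ?_
    have hsub : uIoc 0 x ⊆ Icc 0 1 := by
      rw [uIoc_of_le hx.1]
      exact fun y hy => ⟨hy.1.le, hy.2.trans hx.2⟩
    exact ae_restrict_of_ae_restrict_of_subset hsub (Lp.coeFn_add p.snd q.snd)
  rw [toFun, toFun, toFun, WithLp.add_snd, WithLp.add_fst, h]
  ring

theorem H1Space.toFun_smul (c : ℝ) (p : H1Space) {x : ℝ} (hx : x ∈ Icc (0 : ℝ) 1) :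
    (c • p).toFun x = c * p.toFun x := by
  have h : ∫ y in (0 : ℝ)..x, (c • p.snd) y = c * ∫ y in (0 : ℝ)..x, p.snd y := by
    rw [← intervalIntegral.integral_const_mul]
    refine intervalIntegral.integral_congr_ae_restrict ?_
    have hsub : uIoc 0 x ⊆ Icc 0 1 := by
      rw [uIoc_of_le hx.1]
      exact fun y hy => ⟨hy.1.le, hy.2.trans hx.2⟩
    exact ae_restrict_of_ae_restrict_of_subset hsub (Lp.coeFn_smul c p.snd)
  rw [toFun, toFun, WithLp.smul_snd, WithLp.smul_fst, h, smul_eq_mul]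
  ring

/-- The embedding of `H¹(0,1)` into `C([0,1])`. -/
noncomputable def H1Space.toBCF :
    H1Space →L[ℝ] BoundedContinuousFunction (Icc (0 : ℝ) 1) ℝ :=
  LinearMap.mkContinuous
    { toFun := fun p => BoundedContinuousFunction.mkOfCompact
        ⟨fun x : Icc (0 : ℝ) 1 => p.toFun x, p.continuousOn_toFun.domRestrict⟩
      map_add' := fun p q => by ext x; exact H1Space.toFun_add p q x.2
      map_smul' := fun c p => by ext x; exact H1Space.toFun_smul c p x.2 } 2
    fun p => (BoundedContinuousFunction.norm_le (by positivity)).2 fun x => p.abs_toFun_le x.2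

theorem H1Space.toBCF_apply (p : H1Space) (x : Icc (0 : ℝ) 1) : toBCF p x = p.toFun x := rfl

theorem H1Space.isCompactOperator_toBCF : IsCompactOperator H1Space.toBCF := by
  rw [isCompactOperator_iff_exists_mem_nhds_isCompact_closure_image]
  refine ⟨Metric.closedBall 0 1, Metric.closedBall_mem_nhds 0 one_pos, ?_⟩
  refine BoundedContinuousFunction.arzela_ascoli (Icc (-2) 2) isCompact_Icc _ ?_ ?_
  · rintro f x ⟨p, hp, rfl⟩
    rw [mem_closedBall_zero_iff] at hp
    rw [toBCF_apply]
    exact abs_le.1 ((p.abs_toFun_le x.2).trans (by linarith))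
  · refine Metric.equicontinuous_of_continuity_modulus Real.sqrt
      (by simpa using Real.continuous_sqrt.tendsto 0) _ ?_
    rintro x y ⟨f, p, hp, rfl⟩
    rw [mem_closedBall_zero_iff] at hp
    simp only [toBCF_apply]
    rw [Real.dist_eq, Subtype.dist_eq, Real.dist_eq]
    exact (p.abs_toFun_sub_le y.2 x.2).trans (mul_le_of_le_one_right (Real.sqrt_nonneg _) hp)

theorem memLp_mul_projIcc {a : ℝ → ℝ} (ha : ContinuousOn a (Icc 0 1))
    (f : BoundedContinuousFunction (Icc (0 : ℝ) 1) ℝ) :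
    MemLp (fun x => a x * f (projIcc 0 1 zero_le_one x)) 2 (volume.restrict (Icc 0 1)) :=
  memLp_two_of_continuousOn (ha.mul (f.continuous.comp continuous_projIcc).continuousOn)

/-- Multiplication by a continuous function `a`, from `C([0,1])` to `L²([0,1])`. -/
noncomputable def mulToL2 (a : ℝ → ℝ) (ha : ContinuousOn a (Icc 0 1)) :
    BoundedContinuousFunction (Icc (0 : ℝ) 1) ℝ →L[ℝ] L2Space :=
  LinearMap.mkContinuousOfExistsBound
    { toFun := fun f => (memLp_mul_projIcc ha f).toLp _
      map_add' := fun f g => by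
        rw [← MemLp.toLp_add]
        congr 1; ext x; simp [mul_add]
      map_smul' := fun c f => by
        rw [RingHom.id_apply, ← MemLp.toLp_const_smul]
        congr 1; ext x; simp; ring } <| by
    obtain ⟨C, hC⟩ := isCompact_Icc.exists_bound_of_continuousOn ha
    have hC0 : 0 ≤ C := (norm_nonneg _).trans (hC 0 (by simp))
    refine ⟨C, fun f => ?_⟩
    have h := Lp.norm_le_of_ae_bound (f := (memLp_mul_projIcc ha f).toLp _) (C := C * ‖f‖)
      (by positivity) (by
        filter_upwards [(memLp_mul_projIcc ha f).coeFn_toLp, ae_restrict_mem measurableSet_Icc]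
          with x hx hx1
        rw [hx, norm_mul]
        exact mul_le_mul (hC x hx1) (f.norm_coe_le_norm _) (norm_nonneg _) hC0)
    refine h.trans_eq ?_
    simp [measureUnivNNReal]

/-- The map `p ↦ a p` from `H¹(0,1)` to `L²([0,1])`. -/
noncomputable def H1Space.mulL2 (a : ℝ → ℝ) (ha : ContinuousOn a (Icc 0 1)) :
    H1Space →L[ℝ] L2Space := (mulToL2 a ha).comp H1Space.toBCF

theorem H1Space.mulL2_eq (a : ℝ → ℝ) (ha : ContinuousOn a (Icc 0 1)) (p : H1Space) :
    H1Space.mulL2 a ha p =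
      (memLp_two_of_continuousOn (ha.fun_mul p.continuousOn_toFun)).toLp _ := by
  change (memLp_mul_projIcc ha (toBCF p)).toLp _ = _
  rw [MemLp.toLp_eq_toLp_iff]
  filter_upwards [ae_restrict_mem measurableSet_Icc] with x hx
  rw [toBCF_apply, projIcc_of_mem _ hx]

theorem H1Space.inner_mulL2 (a : ℝ → ℝ) (ha : ContinuousOn a (Icc 0 1)) (p : H1Space)
    {f : ℝ → ℝ} (hf : MemLp f 2 (volume.restrict (Icc 0 1))) :
    inner ℝ (hf.toLp f) (H1Space.mulL2 a ha p) = ∫ x in (0 : ℝ)..1, f x * (a x * p.toFun x) := by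
  rw [mulL2_eq, inner_toLp_eq_integral]

theorem H1Space.isCompactOperator_mulL2 (a : ℝ → ℝ) (ha : ContinuousOn a (Icc 0 1)) :
    IsCompactOperator (H1Space.mulL2 a ha) :=
  H1Space.isCompactOperator_toBCF.clm_comp (mulToL2 a ha)

/-! ### Regularity of weak eigenfunctions. -/

/-- A square integrable function on `[0,1]` which is orthogonal to all test functions vanishes. -/
theorem ae_eq_zero_of_integral_contDiff {f : ℝ → ℝ} (hf : MemLp f 2 (volume.restrict (Icc 0 1)))
    (h : ∀ g : ℝ → ℝ, ContDiff ℝ (⊤ : ℕ∞) g → ∫ x in (0 : ℝ)..1, f x * g x = 0) :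
    f =ᵐ[volume.restrict (Icc 0 1)] 0 := by
  refine ae_eq_zero_of_integral_contDiff_smul_eq_zero
    (hf.integrable (by norm_num)).locallyIntegrable fun g hg _ => ?_
  have := h g hg
  rw [intervalIntegral_eq_integral_restrict] at this
  simpa only [smul_eq_mul, mul_comm] using this

/-- The element of `H¹(0,1)` with value `c` at `0` and derivative `g`. -/
noncomputable def H1Space.mk' (c : ℝ) {g : ℝ → ℝ} (hg : ContinuousOn g (Icc 0 1)) : H1Space :=
  WithLp.toLp 2 (c, (memLp_two_of_continuousOn hg).toLp g)

theorem H1Space.toFun_mk' (c : ℝ) {g : ℝ → ℝ} (hg : ContinuousOn g (Icc 0 1)) {x : ℝ}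
    (hx : x ∈ Icc (0 : ℝ) 1) : (mk' c hg).toFun x = c + ∫ y in (0 : ℝ)..x, g y := by
  change c + ∫ y in (0 : ℝ)..x, (memLp_two_of_continuousOn hg).toLp g y = _
  congr 1
  refine intervalIntegral.integral_congr_ae_restrict ?_
  have hsub : uIoc 0 x ⊆ Icc 0 1 := by
    rw [uIoc_of_le hx.1]
    exact fun y hy => ⟨hy.1.le, hy.2.trans hx.2⟩
  exact ae_restrict_of_ae_restrict_of_subset hsub (MemLp.coeFn_toLp _)

theorem H1Space.inner_snd_mk' (p : H1Space) (c : ℝ) {g : ℝ → ℝ} (hg : ContinuousOn g (Icc 0 1)) :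
    inner ℝ p.snd (mk' c hg).snd = ∫ x in (0 : ℝ)..1, p.snd x * g x := by
  have h := inner_toLp_eq_integral (Lp.memLp p.snd) (memLp_two_of_continuousOn hg)
  rwa [Lp.toLp_coeFn] at h

/-- A weak solution of the Neumann eigenvalue equation is a classical one. -/
theorem H1Space.isNeumannEigenpair {V : ℝ → ℝ} (hV : ContinuousOn V (Icc 0 1)) {κ : ℝ}
    {p : H1Space}
    (hp : ∀ q : H1Space, inner ℝ p.snd q.snd =
      ∫ x in (0 : ℝ)..1, (κ * p.toFun x - V x * p.toFun x) * q.toFun x) :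
    IsNeumannEigenpair V κ p.toFun := by
  set F : ℝ → ℝ := fun x => κ * p.toFun x - V x * p.toFun x with hF
  have hu := p.continuousOn_toFun
  have hFc : ContinuousOn F (Icc 0 1) := (continuousOn_const.mul hu).sub (hV.mul hu)
  have hnc : ContinuousOn (fun x => -F x) (Icc 0 1) := hFc.neg
  -- Candidate for `p'`, the primitive of `(V - κ) p` vanishing at `0`. Testing with the constant
  -- `1` gives `d 1 = 0`; testing with primitives of smooth `g` gives `p' = d` almost everywhere.
  set d : ℝ → ℝ := fun x => 0 + ∫ y in (0 : ℝ)..x, -F y with hd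
  have hd' : ∀ x ∈ Icc (0 : ℝ) 1, HasDerivWithinAt d (-F x) (Icc 0 1) x :=
    hasDerivWithinAt_of_eq_integral hnc fun x _ => rfl
  have hdc := continuousOn_of_hasDerivWithinAt hd'
  have hd0 : d 0 = 0 := by simp [hd]
  have hd1 : d 1 = 0 := by
    have h := hp (mk' 1 (continuousOn_const (c := (0 : ℝ))))
    rw [inner_snd_mk'] at h
    have h2 : ∫ x in (0 : ℝ)..1, F x * (mk' 1 (continuousOn_const (c := (0 : ℝ)))).toFun x =
        ∫ x in (0 : ℝ)..1, F x := intervalIntegral.integral_congr fun x hx => by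
      rw [uIcc_of_le zero_le_one] at hx
      simp [toFun_mk' _ _ hx]
    rw [h2] at h
    simp only [hd, intervalIntegral.integral_neg, ← h]
    simp
  have hpd : (fun x => p.snd x - d x) =ᵐ[volume.restrict (Icc 0 1)] 0 := by
    have hmd := memLp_two_of_continuousOn hdc
    refine ae_eq_zero_of_integral_contDiff ((Lp.memLp p.snd).sub hmd) fun g hg => ?_
    have hgc : ContinuousOn g (Icc 0 1) := hg.continuous.continuousOn
    have hmg := memLp_two_of_continuousOn hgc
    have hG : ∀ x ∈ Icc (0 : ℝ) 1,
        HasDerivWithinAt (mk' 0 hgc).toFun (g x) (Icc 0 1) x :=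
      hasDerivWithinAt_of_eq_integral hgc fun x hx => toFun_mk' 0 hgc hx
    have h1 := integral_mul_deriv_Icc hG hd' hgc hnc
    have h2 := hp (mk' 0 hgc)
    rw [inner_snd_mk'] at h2
    rw [hd0, hd1] at h1
    have h3 : ∫ x in (0 : ℝ)..1, (mk' 0 hgc).toFun x * -F x =
        -∫ x in (0 : ℝ)..1, F x * (mk' 0 hgc).toFun x := by
      rw [← intervalIntegral.integral_neg]
      congr 1; ext x; ring
    have h4 : ∫ x in (0 : ℝ)..1, (p.snd x - d x) * g x =
        (∫ x in (0 : ℝ)..1, p.snd x * g x) - ∫ x in (0 : ℝ)..1, g x * d x := by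
      rw [← intervalIntegral.integral_sub (intervalIntegrable_mul (Lp.memLp p.snd) hmg)
        (intervalIntegrable_mul hmg hmd)]
      congr 1; ext x; ring
    rw [h4, h2]
    linarith
  refine ⟨d, hasDerivWithinAt_of_eq_integral (c := p.fst) hdc fun x hx => ?_,
    fun x hx => (hd' x hx).congr_deriv (by simp only [hF]; ring), hd0, hd1⟩
  rw [toFun]
  congr 1
  refine intervalIntegral.integral_congr_ae_restrict ?_
  have hsub : uIoc 0 x ⊆ Icc 0 1 := by
    rw [uIoc_of_le hx.1]
    exact fun y hy => ⟨hy.1.le, hy.2.trans hx.2⟩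
  filter_upwards [ae_restrict_of_ae_restrict_of_subset hsub hpd] with y hy
  exact sub_eq_zero.1 hy

/-! ### The energy form and the compact inverse. -/

section EnergyForm

variable {V : ℝ → ℝ} (hV : ContinuousOn V (Icc 0 1))

/-- The inclusion of `H¹(0,1)` in `L²([0,1])`. -/
noncomputable def H1Space.toL2 : H1Space →L[ℝ] L2Space :=
  H1Space.mulL2 (fun _ => 1) continuousOn_const

/-- The quadratic form `∫ p' q' + V p q` on `H¹(0,1)`. -/
noncomputable def energyForm : H1Space →L[ℝ] H1Space →L[ℝ] ℝ :=
  LinearMap.mkContinuous₂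
    (LinearMap.mk₂ ℝ
      (fun p q : H1Space => inner ℝ p.snd q.snd + inner ℝ (H1Space.mulL2 V hV p) (H1Space.toL2 q))
      (fun p p' q => by rw [WithLp.add_snd, map_add, inner_add_left, inner_add_left]; ring)
      (fun c p q => by
        rw [WithLp.smul_snd, map_smul, real_inner_smul_left, real_inner_smul_left, smul_eq_mul]
        ring)
      (fun p q q' => by rw [WithLp.add_snd, map_add, inner_add_right, inner_add_right]; ring)
      (fun c p q => by
        rw [WithLp.smul_snd, map_smul, real_inner_smul_right, real_inner_smul_right, smul_eq_mul]
        ring))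
    (1 + ‖H1Space.mulL2 V hV‖ * ‖H1Space.toL2‖) fun p q => by
      rw [LinearMap.mk₂_apply]
      refine (norm_add_le _ _).trans ?_
      have h1 : ‖inner ℝ p.snd q.snd‖ ≤ ‖p‖ * ‖q‖ := (norm_inner_le_norm _ _).trans
        (mul_le_mul p.norm_snd_le q.norm_snd_le (norm_nonneg _) (norm_nonneg _))
      have h2 : ‖inner ℝ (H1Space.mulL2 V hV p) (H1Space.toL2 q)‖ ≤
          (‖H1Space.mulL2 V hV‖ * ‖p‖) * (‖H1Space.toL2‖ * ‖q‖) := (norm_inner_le_norm _ _).trans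
        (mul_le_mul (ContinuousLinearMap.le_opNorm _ _) (ContinuousLinearMap.le_opNorm _ _)
          (norm_nonneg _) (by positivity))
      linarith

theorem energyForm_apply (p q : H1Space) :
    energyForm hV p q = inner ℝ p.snd q.snd +
      ∫ x in (0 : ℝ)..1, V x * p.toFun x * q.toFun x := by
  change inner ℝ p.snd q.snd + inner ℝ (H1Space.mulL2 V hV p) (H1Space.toL2 q) = _
  rw [H1Space.mulL2_eq, H1Space.toL2, H1Space.inner_mulL2]
  simp_rw [one_mul]

theorem energyForm_symm (p q : H1Space) : energyForm hV p q = energyForm hV q p := by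
  rw [energyForm_apply, energyForm_apply, real_inner_comm]
  congr 2; ext x; ring

theorem isCoercive_energyForm (hV0 : ∀ x ∈ Icc (0 : ℝ) 1, 0 < V x) :
    IsCoercive (energyForm hV) := by
  obtain ⟨x₀, hx₀, hmin⟩ := isCompact_Icc.exists_isMinOn (nonempty_Icc.2 zero_le_one) hV
  have hm : 0 < V x₀ := hV0 x₀ hx₀
  set m := V x₀
  have hK : 0 < 2 / m + 3 := by positivity
  refine ⟨(2 / m + 3)⁻¹, inv_pos.2 hK, fun p => ?_⟩
  have hu := p.continuousOn_toFun
  set w := ‖p.snd‖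
  set I := ∫ x in (0 : ℝ)..1, V x * p.toFun x * p.toFun x
  have hiI := intervalIntegrable_of_continuousOn_Icc ((hV.fun_mul hu).fun_mul hu)
  -- The norm of `H1Space` involves `p(0)`, recovered from `p(0)² ≤ 2 p(x)² + 2 ‖p'‖²` by
  -- integrating in `x` and using `p² ≤ V p² / m`. Adding `‖p'‖²` explains the constant `2 / m + 3`.
  have h1 : p.fst ^ 2 ≤ 2 / m * I + 2 * w ^ 2 := by
    have := intervalIntegral.integral_mono_on (zero_le_one (α := ℝ)) (f := fun _ => p.fst ^ 2)
      (g := fun x => 2 / m * (V x * p.toFun x * p.toFun x) + 2 * w ^ 2) intervalIntegrable_const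
      ((hiI.const_mul _).add intervalIntegrable_const) fun x hx => by
        have h2 := sq_le_sq' (neg_le_of_abs_le (p.abs_toFun_sub_fst_le hx))
          (le_of_abs_le (p.abs_toFun_sub_fst_le hx))
        have h3 : p.toFun x ^ 2 ≤ V x / m * p.toFun x ^ 2 :=
          le_mul_of_one_le_left (sq_nonneg _) ((one_le_div hm).2 (hmin hx))
        have h4 : 2 / m * (V x * p.toFun x * p.toFun x) = 2 * (V x / m * p.toFun x ^ 2) := by
          ring
        rw [h4]
        nlinarith [sq_nonneg (2 * p.toFun x - p.fst)]
    rw [intervalIntegral.integral_add (hiI.const_mul _) intervalIntegrable_const,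
      intervalIntegral.integral_const_mul] at this
    simpa using this
  have hI0 : 0 ≤ I := intervalIntegral.integral_nonneg zero_le_one fun x hx => by
    rw [mul_assoc]
    exact mul_nonneg (hV0 x hx).le (mul_self_nonneg _)
  rw [energyForm_apply, real_inner_self_eq_norm_sq, mul_assoc, ← sq, inv_mul_le_iff₀ hK,
    WithLp.prod_norm_sq_eq_of_L2, Real.norm_eq_abs, sq_abs]
  have hm2 : 0 < 2 / m := by positivity
  nlinarith [mul_nonneg hm2.le (sq_nonneg w)]

end EnergyForm

/-- The inverse of `-∂ₓₓ + V` with Neumann boundary conditions is compact, self-adjoint and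
injective, and its eigenvectors are classical eigenfunctions. -/
theorem exists_compact_inverse {V : ℝ → ℝ} (hV : ContinuousOn V (Icc 0 1))
    (hV0 : ∀ x ∈ Icc (0 : ℝ) 1, 0 < V x) :
    ∃ T : L2Space →L[ℝ] L2Space, IsCompactOperator T ∧ T.IsSymmetric ∧
      ∀ (r : ℝ) (f : L2Space), f ≠ 0 → T f = r • f → r ≠ 0 ∧
        ∃ w : ℝ → ℝ, IsNeumannEigenpair V r⁻¹ w ∧ f =ᵐ[volume.restrict (Icc 0 1)] w := by
  have hco := isCoercive_energyForm hV hV0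
  set A := hco.continuousLinearEquivOfBilin
  set J := H1Space.toL2
  -- `S f` is the Lax-Milgram solution of `B(S f, q) = ⟨f, J q⟩`, with `B` the energy form; the
  -- inverse operator is `J ∘ S`.
  let S : L2Space →L[ℝ] H1Space :=
    (A.symm : H1Space →L[ℝ] H1Space).comp (ContinuousLinearMap.adjoint J)
  have hS : ∀ f q, energyForm hV (S f) q = inner ℝ f (J q) := by
    intro f q
    rw [← hco.continuousLinearEquivOfBilin_apply]
    change inner ℝ (A (A.symm (ContinuousLinearMap.adjoint J f))) q = _
    rw [A.apply_symm_apply, ContinuousLinearMap.adjoint_inner_left]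
  have hJ : ∀ (f : L2Space) q, inner ℝ f (J q) = ∫ x in (0 : ℝ)..1, f x * q.toFun x := by
    intro f q
    have h := H1Space.inner_mulL2 (fun _ => 1) continuousOn_const q (Lp.memLp f)
    rw [Lp.toLp_coeFn] at h
    simp_rw [one_mul] at h
    exact h
  refine ⟨J.comp S, (H1Space.isCompactOperator_mulL2 (fun _ => 1) continuousOn_const).comp_clm S, fun f g => ?_,
    fun r f hf hTf => ?_⟩
  · change inner ℝ (J (S f)) g = inner ℝ f (J (S g))
    rw [← hS f, real_inner_comm, ← hS g, energyForm_symm]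
  have hJS : J (S f) = r • f := hTf
  -- If `J (S f) = 0`, then `B(S f, S f) = 0`, so `S f = 0` by coercivity. Then `f` is orthogonal to
  -- the image of `J`, which contains the smooth functions, and so `f = 0`.
  have hr : r ≠ 0 := by
    rintro rfl
    rw [zero_smul] at hJS
    have h0 := hS f (S f)
    rw [hJS, inner_zero_right] at h0
    obtain ⟨C, hC, hle⟩ := hco
    have h1 := hle (S f)
    rw [h0] at h1
    have h2 : S f = 0 := by
      by_contra hne
      have := norm_pos_iff.2 hne
      have : 0 < C * ‖S f‖ * ‖S f‖ := by positivity
      linarith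
    refine hf ((Lp.eq_zero_iff_ae_eq_zero).2
      (ae_eq_zero_of_integral_contDiff (Lp.memLp f) fun g hg => ?_))
    have hgd : ContinuousOn (deriv g) (Icc 0 1) :=
      (hg.continuous_deriv (by simp)).continuousOn
    have h3 := hS f (H1Space.mk' (g 0) hgd)
    rw [h2, map_zero, zero_apply, hJ] at h3
    refine Eq.trans ?_ h3.symm
    refine intervalIntegral.integral_congr fun x hx => ?_
    rw [uIcc_of_le zero_le_one] at hx
    have h4 := integral_deriv_Icc (u := g) (u' := deriv g) (fun x _ =>
      ((hg.differentiable (by simp)) x).hasDerivAt.hasDerivWithinAt) hgd (a := 0) (by simp) hx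
    rw [H1Space.toFun_mk' _ _ hx, h4]
    ring
  -- This multiple of `S f` represents `f` itself, so the defining relation of `S` becomes the weak
  -- eigenvalue equation with `κ = r⁻¹`.
  set p : H1Space := r⁻¹ • S f with hp
  have hJp : J p = f := by rw [hp, map_smul, hJS, smul_smul, inv_mul_cancel₀ hr, one_smul]
  have hfp : f =ᵐ[volume.restrict (Icc 0 1)] p.toFun := by
    have h : f = MemLp.toLp _ _ := hJp.symm.trans (H1Space.mulL2_eq _ continuousOn_const p)
    rw [h]
    filter_upwards [MemLp.coeFn_toLp (memLp_two_of_continuousOn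
      ((continuousOn_const (c := (1 : ℝ))).fun_mul p.continuousOn_toFun))] with x hx
    rw [hx, one_mul]
  refine ⟨hr, p.toFun, H1Space.isNeumannEigenpair hV fun q => ?_, hfp⟩
  have hu := p.continuousOn_toFun
  have hq := q.continuousOn_toFun
  have h1 : energyForm hV p q = r⁻¹ * ∫ x in (0 : ℝ)..1, p.toFun x * q.toFun x := by
    rw [hp, map_smul, smul_apply, hS, hJ, smul_eq_mul, ← hp,
      intervalIntegral_eq_integral_restrict, intervalIntegral_eq_integral_restrict]
    congr 1
    refine integral_congr_ae ?_
    filter_upwards [hfp] with x hx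
    rw [hx]
  rw [energyForm_apply] at h1
  rw [eq_sub_of_add_eq h1, ← intervalIntegral.integral_const_mul,
    ← intervalIntegral.integral_sub
      ((intervalIntegrable_of_continuousOn_Icc (hu.fun_mul hq)).const_mul _)
      (intervalIntegrable_of_continuousOn_Icc ((hV.fun_mul hu).fun_mul hq))]
  congr 1; ext x; ring

/-! ### Construction of the ordered eigensystem. -/

/-- An infinite family of distinct reals with finite sublevel sets can be listed in increasing
order. -/
theorem exists_equiv_nat_monotone {ι : Type*} [Infinite ι] {m : ι → ℝ}
    (hm : Function.Injective m) (hfin : ∀ M, {i | m i ≤ M}.Finite) :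
    ∃ σ : ℕ ≃ ι, Monotone (m ∘ σ) := by
  -- The rank `r i` counts the values below `m i`. It is injective, and its range, an infinite
  -- subset of `ℕ`, is order isomorphic to `ℕ`.
  set r : ι → ℕ := fun i => {j | m j < m i}.ncard
  have hfin' : ∀ i, {j | m j < m i}.Finite := fun i =>
    (hfin (m i)).subset fun j (hj : m j < m i) => hj.le
  have hlt : ∀ i j, m i < m j → r i < r j := fun i j hij =>
    ncard_lt_ncard ⟨fun k (hk : m k < m i) => hk.trans hij,
      fun h => lt_irrefl (m i) (h (show i ∈ {k | m k < m j} from hij))⟩ (hfin' j)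
  have hinj : Function.Injective r := fun i j hij => by
    by_contra hne
    rcases (hm.ne hne).lt_or_gt with h | h
    · exact (hlt i j h).ne hij
    · exact (hlt j i h).ne' hij
  classical
  have : Infinite (range r) := (infinite_range_of_injective hinj).to_subtype
  have : DecidablePred (· ∈ range r) := fun _ => Classical.dec _
  set o := Nat.Subtype.orderIsoOfNat (range r)
  set ρ := Equiv.ofInjective r hinj
  refine ⟨o.toEquiv.trans ρ.symm, fun n k hnk => ?_⟩
  by_contra! hlt'
  have h1 := hlt _ _ hlt'
  have h2 : ∀ n, r (ρ.symm (o n)) = o n := fun n => congrArg Subtype.val (ρ.apply_symm_apply (o n))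
  have h3 : (o n : ℕ) ≤ o k := o.monotone hnk
  simp only [Equiv.trans_apply, RelIso.coe_fn_toEquiv, h2] at h1
  lia

/-- Polynomials embed in `L²`: one vanishing almost everywhere on `[0,1]` has infinitely many roots.
This forces infinitely many eigenvalues. -/
theorem not_finiteDimensional_L2Space : ¬ FiniteDimensional ℝ L2Space := by
  intro hfd
  have hm : ∀ P : Polynomial ℝ, MemLp (fun x => P.eval x) 2 (volume.restrict (Icc (0 : ℝ) 1)) :=
    fun P => memLp_two_of_continuousOn P.continuous.continuousOn
  let Φ : Polynomial ℝ →ₗ[ℝ] L2Space :=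
    { toFun := fun P => (hm P).toLp _
      map_add' := fun P Q => by
        rw [← MemLp.toLp_add]
        congr 1; ext x; simp
      map_smul' := fun c P => by
        rw [RingHom.id_apply, ← MemLp.toLp_const_smul]
        congr 1; ext x; simp }
  have hinj : Function.Injective Φ := by
    rw [injective_iff_map_eq_zero]
    intro P hP
    have h0 : (fun x => P.eval x) =ᵐ[volume.restrict (Icc (0 : ℝ) 1)] fun _ => 0 :=
      (hm P).coeFn_toLp.symm.trans ((Lp.eq_zero_iff_ae_eq_zero).1 hP)
    have h1 := Measure.eqOn_Icc_of_ae_eq volume zero_ne_one h0 P.continuous.continuousOn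
      continuousOn_const
    exact Polynomial.eq_zero_of_infinite_isRoot P
      ((Icc_infinite (zero_lt_one (α := ℝ))).mono fun x hx => h1 hx)
  have := Module.Finite.of_injective Φ hinj
  exact Polynomial.not_finite this

/-- A compact self-adjoint injective operator has a total orthonormal family of eigenvectors. -/
theorem exists_orthonormal_eigenvectors {H : Type*} [NormedAddCommGroup H] [InnerProductSpace ℝ H]
    [CompleteSpace H] {T : H →L[ℝ] H} (hTc : IsCompactOperator T) (hTs : T.IsSymmetric)
    (hT0 : ∀ f, T f = 0 → f = 0) :
    ∃ (ι : Type) (b : ι → H) (r : ι → ℝ), Orthonormal ℝ b ∧ (∀ i, T (b i) = r i • b i) ∧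
      ∀ u, (∀ i, inner ℝ (b i) u = 0) → u = 0 := by
  set W : ℝ → Submodule ℝ H := Module.End.eigenspace (T : Module.End ℝ H)
  -- The kernel is trivial and compactness handles the other eigenspaces, so each has a finite
  -- orthonormal basis; together these form the family.
  have hfd : ∀ r : ℝ, FiniteDimensional ℝ (W r) := by
    intro r
    by_cases hr : r = 0
    · have : W r = ⊥ := by
        rw [Submodule.eq_bot_iff]
        intro f hf
        refine hT0 f ?_
        have := Module.End.mem_eigenspace_iff.1 hf
        rwa [hr, zero_smul] at this
      rw [this]; infer_instance
    · exact ContinuousLinearMap.finite_dimensional_eigenspace hTc r hr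
  refine ⟨Σ r : ℝ, Fin (Module.finrank ℝ (W r)),
    fun i => (stdOrthonormalBasis ℝ (W i.1) i.2 : H), fun i => i.1,
    hTs.orthogonalFamily_eigenspaces.orthonormal_sigma_orthonormal
      fun r => (stdOrthonormalBasis ℝ (W r)).orthonormal,
    fun i => Module.End.mem_eigenspace_iff.1 (Subtype.mem (stdOrthonormalBasis ℝ (W i.1) i.2)),
    fun u hu => ?_⟩
  have h := ContinuousLinearMap.orthogonalComplement_iSup_eigenspaces_eq_bot hTc hTs
  rw [← Submodule.iInf_orthogonal] at h
  rw [← Submodule.mem_bot ℝ, ← h, Submodule.mem_iInf]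
  intro r
  rw [Submodule.mem_orthogonal]
  intro w hw
  have h1 := congrArg Subtype.val ((stdOrthonormalBasis ℝ (W r)).sum_repr ⟨w, hw⟩)
  rw [Submodule.coe_sum] at h1
  have h2 : w = ∑ i, (stdOrthonormalBasis ℝ (W r)).repr ⟨w, hw⟩ i •
      (stdOrthonormalBasis ℝ (W r) i : H) := h1.symm
  rw [h2, sum_inner]
  exact Finset.sum_eq_zero fun i _ => by rw [real_inner_smul_left, hu ⟨r, i⟩, mul_zero]

/-- The eigenvalues and eigenfunctions of `-∂ₓₓ + V` with Neumann boundary conditions. -/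
theorem exists_isNeumannEigensystem {V : ℝ → ℝ} (hV : ContinuousOn V (Icc 0 1))
    (hV0 : ∀ x ∈ Icc (0 : ℝ) 1, 0 < V x) :
    ∃ (μ : ℕ → ℝ) (e : ℕ → ℝ → ℝ), IsNeumannEigensystem V μ e := by
  classical
  obtain ⟨T, hTc, hTs, hT⟩ := exists_compact_inverse hV hV0
  have hT0 : ∀ f, T f = 0 → f = 0 := fun f hf => by
    by_contra hne
    exact (hT 0 f hne (by rw [hf, zero_smul])).1 rfl
  obtain ⟨ι, b, r, hb, hTb, hcomp⟩ := exists_orthonormal_eigenvectors hTc hTs hT0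
  have hbT : ∀ i : ι, ∃ w : ℝ → ℝ, IsNeumannEigenpair V (r i)⁻¹ w ∧
      b i =ᵐ[volume.restrict (Icc 0 1)] w := fun i => (hT (r i) (b i) (hb.ne_zero i) (hTb i)).2
  choose w hw hbw using hbT
  have hwm := fun i => memLp_two_of_continuousOn (hw i).continuousOn
  have hbw' : ∀ i, b i = (hwm i).toLp (w i) := fun i =>
    Lp.ext ((hbw i).trans (hwm i).coeFn_toLp.symm)
  have ho : ∀ i j, ∫ x in (0 : ℝ)..1, w i x * w j x = if i = j then 1 else 0 := by
    intro i j
    rw [← inner_toLp_eq_integral (hwm i) (hwm j), ← hbw', ← hbw']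
    exact orthonormal_iff_ite.1 hb i j
  have hinj := eigenvalue_injective hV hw ho
  have hnn := eigenvalue_nonneg hV hV0 hw ho
  have : Infinite ι := by
    by_contra hfin
    rw [not_infinite_iff_finite] at hfin
    have htop : Submodule.span ℝ (range b) = ⊤ := by
      have : FiniteDimensional ℝ (Submodule.span ℝ (range b)) :=
        FiniteDimensional.span_of_finite ℝ (finite_range b)
      rw [← Submodule.orthogonal_eq_bot_iff, Submodule.eq_bot_iff]
      exact fun u hu => hcomp u fun i =>
        (Submodule.mem_orthogonal _ _).1 hu _ (Submodule.subset_span (mem_range_self i))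
    exact not_finiteDimensional_L2Space
      (Module.finite_def.2 (htop ▸ Submodule.fg_span (finite_range b)))
  -- Each eigenvalue at most `M` contributes at least `1 / (1 + |M|)` to a sum bounded by `2`, so
  -- there are at most `2 (1 + |M|)` of them.
  have hsub : ∀ M : ℝ, {i : ι | (r i)⁻¹ ≤ M}.Finite := by
    intro M
    by_contra hinf
    obtain ⟨s, hs, hcard⟩ := (Set.not_finite.1 hinf).exists_subset_card_eq
      (⌈2 * (1 + |M|)⌉₊ + 1)
    have h1 := sum_inv_le hV hV0 hw ho s
    have hM : 0 < 1 + |M| := by positivity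
    have h2 : ∑ i ∈ s, (1 + |M|)⁻¹ ≤ ∑ i ∈ s, (1 + (r i)⁻¹)⁻¹ := Finset.sum_le_sum fun i hi =>
      inv_anti₀ (by linarith [hnn i]) (by
        have : (r i)⁻¹ ≤ M := hs hi
        linarith [le_abs_self M])
    rw [Finset.sum_const, hcard, nsmul_eq_mul, ← div_eq_mul_inv] at h2
    have h3 := (div_le_iff₀ hM).1 (h2.trans h1)
    have h4 := Nat.le_ceil (2 * (1 + |M|))
    push_cast at h3
    linarith
  obtain ⟨σ, hσ⟩ := exists_equiv_nat_monotone hinj hsub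
  refine ⟨fun n => (r (σ n))⁻¹, fun n => w (σ n), hσ, fun n => hw (σ n), fun m n => ?_,
    fun f hf h0 => ?_⟩
  · rw [ho]
    simp only [σ.injective.eq_iff]
  · have h1 : hf.toLp f = 0 := hcomp _ fun i => by
      rw [hbw', inner_toLp_eq_integral, ← σ.apply_symm_apply i]
      exact h0 _
    exact hf.coeFn_toLp.symm.trans ((Lp.eq_zero_iff_ae_eq_zero).1 h1)

end NeumannHeat

/-! ### The main theorem. -/

theorem mainTheorem9 :
    ∃ C₁ : ℝ, 0 < C₁ ∧
      ∀ V : ℝ → ℝ, ContinuousOn V (Icc 0 1) → (∀ x ∈ Icc (0 : ℝ) 1, 0 < V x) →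
        (∃ (μ : ℕ → ℝ) (e : ℕ → ℝ → ℝ), NeumannHeat.IsNeumannEigensystem V μ e) ∧
        (∀ v₀ : ℝ → ℝ, NeumannHeat.PPlus v₀ →
          ∃ v : ℝ → ℝ → ℝ, NeumannHeat.IsHeatSolution V v₀ v) ∧
        ∀ (μ : ℕ → ℝ) (e : ℕ → ℝ → ℝ), NeumannHeat.IsNeumannEigensystem V μ e →
          -- first estimate
          (∀ (v₀ : ℝ → ℝ) (v : ℝ → ℝ → ℝ), NeumannHeat.PPlus v₀ →
            NeumannHeat.IsHeatSolution V v₀ v → ∀ t : ℝ, 0 ≤ t →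
              |Real.exp (μ 0 * t) * (∫ ξ in (0 : ℝ)..1, v t ξ) -
                  NeumannHeat.coeff e 0 v₀ * ∫ ξ in (0 : ℝ)..1, e 0 ξ| ≤
                Real.exp (-(μ 1 - μ 0) * t) *
                  NeumannHeat.l2norm (fun x => v₀ x - NeumannHeat.coeff e 0 v₀ * e 0 x) *
                  NeumannHeat.l2norm
                    (fun x => 1 - NeumannHeat.coeff e 0 (fun _ => 1) * e 0 x)) ∧
          -- the function `h₁` is well defined on `]0,∞[`, decreasing, with limit zero at infinity
          (∀ t : ℝ, 0 < t → Summable (NeumannHeat.h1Term μ t)) ∧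
          StrictAntiOn (NeumannHeat.h1 C₁ μ) (Ioi 0) ∧
          Tendsto (NeumannHeat.h1 C₁ μ) atTop (𝓝 0) ∧
          -- second estimate
          (∀ (v₀ : ℝ → ℝ) (v : ℝ → ℝ → ℝ), NeumannHeat.PPlus v₀ →
            NeumannHeat.IsHeatSolution V v₀ v → ∀ t : ℝ, 0 < t → ∀ x ∈ Icc (0 : ℝ) 1,
              |Real.exp (μ 0 * t) * v t x - NeumannHeat.coeff e 0 v₀ * e 0 x| ≤
                NeumannHeat.l2norm (fun x => v₀ x - NeumannHeat.coeff e 0 v₀ * e 0 x) *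
                  NeumannHeat.h1 C₁ μ t) := by
  -- `√2` is the square root of the constant in the Sobolev inequality `sq_le_two_mul_integral`,
  -- hence independent of `V`.
  refine ⟨Real.sqrt 2, Real.sqrt_pos.2 two_pos, fun V hV hV0 => ?_⟩
  obtain ⟨μ₀, e₀, hS₀⟩ := NeumannHeat.exists_isNeumannEigensystem hV hV0
  refine ⟨⟨μ₀, e₀, hS₀⟩, fun v₀ hv₀ => hS₀.exists_isHeatSolution hV hV0 hv₀.memLp,
    fun μ e hS => ⟨fun v₀ v hv₀ hv t ht => hS.abs_mean_sub_le hV hv₀.continuousOn hv ht,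
      fun t ht => hS.summable_h1Term hV hV0 ht, hS.strictAntiOn_h1 hV hV0 (Real.sqrt_pos.2 two_pos),
      hS.tendsto_h1 hV hV0 _,
      fun v₀ v hv₀ hv t ht x hx => hS.abs_sub_le_h1 hV hV0 hv₀.continuousOn hv ht hx⟩⟩
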